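/- There is an absolute constant $C$ such that the following holds. Let $r\ge 1$ be an integer, let $G$ be a finite simple undirected graph with nonnegative real edge weights that is $K_r$-minor-free (it has no $r$ pairwise disjoint, nonempty, connected vertex sets every two of which are joined by an edge), and let $\Delta>0$ be a real number. Then there is a partition $\mathcal C$ of $V(G)$ into clusters, each inducing a connected subgraph of $G$, such that: 1. each cluster $S\in\mathcal C$ has strong diameter at most $4\Delta$, that is, the induced weighted subgraph $G[S]$ has diameter at most $4\Delta$; 2. every path $P$ in $G$ whose length $\|P\|$ (the sum of the weights of its edges) satisfies $\|P\|<\Delta/r$ has $\mathrm{cost}_{\mathcal C}(P)\le r^{Cr}$. Here the cluster graph $\check G$ has the clusters as its vertices, with two distinct clusters adjacent if some edge of $G$ has one endpoint in each; and $\mathrm{cost}_{\mathcal C}(P)$ is the minimum number of edges of a path in $\check G$ between the clusters containing the two endpoints of $P$ that uses only clusters containing at least one vertex of $P$. -/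

import Mathlib

open scoped NNReal ENNReal

/-- `H` is a minor of `G`: there are pairwise disjoint, nonempty, connected vertex sets
(branch sets) of `G`, one for each vertex of `H`, such that the branch sets of adjacent vertices
of `H` are joined by an edge of `G`. (`Connected` includes nonemptiness.) -/
def IsGraphMinor {W V : Type*} (H : SimpleGraph W) (G : SimpleGraph V) : Prop :=
  ∃ B : W → Set V,
    (∀ i, (G.induce (B i)).Connected) ∧
    (∀ i j, i ≠ j → Disjoint (B i) (B j)) ∧
    (∀ i j, H.Adj i j → ∃ x ∈ B i, ∃ y ∈ B j, G.Adj x y)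

/-- `G` is `K_r`-minor-free, where `⊤` is the complete graph on `r` vertices. -/
def CompleteMinorFree {V : Type*} (r : ℕ) (G : SimpleGraph V) : Prop :=
  ¬ IsGraphMinor (⊤ : SimpleGraph (Fin r)) G

/-- The length of a walk with respect to nonnegative edge weights `w`. Only the values of `w` on
the edges of `G` are ever used. -/
def weightedLength {V : Type*} {G : SimpleGraph V} (w : Sym2 V → ℝ≥0) {u v : V}
    (p : G.Walk u v) : ℝ≥0 :=
  (p.edges.map w).sum

/-- The weighted shortest-path distance, which is `∞` between different components. -/
noncomputable def weightedDist {V : Type*} (G : SimpleGraph V) (w : Sym2 V → ℝ≥0) (u v : V) :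
    ℝ≥0∞ :=
  ⨅ p : G.Walk u v, (weightedLength w p : ℝ≥0∞)

/-- The diameter of a weighted graph. -/
noncomputable def weightedDiam {V : Type*} (G : SimpleGraph V) (w : Sym2 V → ℝ≥0) : ℝ≥0∞ :=
  ⨆ (u : V) (v : V), weightedDist G w u v

/-- The strong diameter of a vertex set `S`: the diameter of the induced subgraph `G[S]`, with
the edge weights inherited from `G`. -/
noncomputable def strongDiam {V : Type*} (G : SimpleGraph V) (w : Sym2 V → ℝ≥0) (S : Set V) :
    ℝ≥0∞ :=
  weightedDiam (G.induce S) (fun e => w (e.map Subtype.val))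

/-- The cluster graph of a partition of the vertices of `G`. The partition is given as an
equivalence relation `s`, whose classes are the clusters. Two distinct clusters are adjacent if
some edge of `G` has one endpoint in each. -/
def clusterGraph {V : Type*} (G : SimpleGraph V) (s : Setoid V) : SimpleGraph (Quotient s) where
  Adj A B := A ≠ B ∧ ∃ x y : V, G.Adj x y ∧ Quotient.mk s x = A ∧ Quotient.mk s y = B
  symm := ⟨fun _ _ ⟨h, x, y, hxy, hx, hy⟩ => ⟨h.symm, y, x, hxy.symm, hy, hx⟩⟩
  loopless := ⟨fun _ h => h.1 rfl⟩

/-- The cost of `P` with respect to the clusters of `s`: the minimum hop-length of a path in the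
cluster graph between the clusters of the endpoints of `P` that only uses clusters containing a
vertex of `P` (and `∞` if there were no such path). -/
noncomputable def pathCost {V : Type*} {G : SimpleGraph V} (s : Setoid V) {u v : V}
    (P : G.Walk u v) : ℕ∞ :=
  ⨅ (Q : (clusterGraph G s).Walk (Quotient.mk s u) (Quotient.mk s v))
    (_ : Q.IsPath ∧ ∀ c ∈ Q.support, ∃ x ∈ P.support, Quotient.mk s x = c), (Q.length : ℕ∞)

/-! The vertices are grouped into connected supernodes, forming a buffered cop decomposition, and
each supernode is then cut into Voronoi cells around its centres. During the construction every
component H of the unassigned part has a set of live supernodes. These are connected and pairwise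
adjacent, so `card_live_lt` leaves fewer than r of them. If all of them touch H, `exists_create`
adds a supernode made of shortest walks in H to a common root, one from a neighbour of each live
supernode. If a live X no longer touches H, `exists_grow` lets the later supernodes around H absorb
the vertices of H within Δ/r of them, after which X is not live. The absorbed layer is a buffer
between X and what remains of H. Each growth adds Δ/r to the radius of a supernode Y and uses up a
live supernode older than Y, so the radius stays below 2Δ; this gives strong diameter at most 4Δ.

Now take a path shorter than Δ/r and let X be the earliest supernode it meets. The path stays in the
component where X was created. The walks of X are shortest there, so at most 6r centres of X are
pairwise close (`exists_skeleton`), and the path meets at most 6r clusters of X. Outside them, the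
buffers force every vertex to lie in a supernode with X as an ancestor. A supernode has fewer than r
ancestors, so this recursion (`hop_of_short`) has depth at most r, and each level multiplies the
number of hops by about 6r + 1 (`hop_of_cut`). -/

/-! ### Weighted walks and connectivity inside a vertex set -/

section WalkLength

variable {V : Type*} {G : SimpleGraph V} {w : Sym2 V → ℝ≥0}

@[simp] lemma weightedLength_nil (u : V) :
    weightedLength w (SimpleGraph.Walk.nil : G.Walk u u) = 0 := by
  simp [weightedLength]

@[simp] lemma weightedLength_cons {u v x : V} (h : G.Adj u v) (p : G.Walk v x) :
    weightedLength w (SimpleGraph.Walk.cons h p) = w s(u, v) + weightedLength w p := by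
  simp [weightedLength]

@[simp] lemma weightedLength_append {u v x : V} (p : G.Walk u v) (q : G.Walk v x) :
    weightedLength w (p.append q) = weightedLength w p + weightedLength w q := by
  simp [weightedLength]

@[simp] lemma weightedLength_reverse {u v : V} (p : G.Walk u v) :
    weightedLength w p.reverse = weightedLength w p := by
  simp [weightedLength]

lemma weightedLength_le_of_sublist {u v u' v' : V} {p : G.Walk u v} {q : G.Walk u' v'}
    (h : List.Sublist p.edges q.edges) : weightedLength w p ≤ weightedLength w q :=
  (h.map w).sum_le_sum (fun _ _ => zero_le)

lemma weightedLength_bypass_le [DecidableEq V] {u v : V} (p : G.Walk u v) :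
    weightedLength w p.bypass ≤ weightedLength w p :=
  weightedLength_le_of_sublist p.edges_bypass_sublist_edges

lemma weightedLength_dropUntil_le [DecidableEq V] {u v x : V} (p : G.Walk u v)
    (h : x ∈ p.support) : weightedLength w (p.dropUntil x h) ≤ weightedLength w p :=
  weightedLength_le_of_sublist (p.edges_dropUntil_suffix_edges h).sublist

lemma weightedLength_takeUntil_le [DecidableEq V] {u v x : V} (p : G.Walk u v)
    (h : x ∈ p.support) : weightedLength w (p.takeUntil x h) ≤ weightedLength w p := by
  conv_rhs => rw [← p.take_spec h, weightedLength_append]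
  exact le_self_add

/-- Loop erasure only drops edges, so it suffices to minimise over paths, of which there are
finitely many. -/
lemma exists_shortest_walk [Finite V] {S : Set V} {x y : V}
    (h : ∃ p : G.Walk x y, ∀ z ∈ p.support, z ∈ S) :
    ∃ p : G.Walk x y, (∀ z ∈ p.support, z ∈ S) ∧
      ∀ q : G.Walk x y, (∀ z ∈ q.support, z ∈ S) → weightedLength w p ≤ weightedLength w q := by
  classical
  have := Fintype.ofFinite V
  have key : ∀ q : G.Walk x y, (∀ z ∈ q.support, z ∈ S) →
      q.toPath ∈ {P : G.Path x y | ∀ z ∈ P.1.support, z ∈ S} := fun q hq z hz =>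
    hq z (q.support_bypass_subset_support hz)
  obtain ⟨p₀, hp₀⟩ := h
  obtain ⟨P, hP, hmin⟩ := Set.exists_min_image {P : G.Path x y | ∀ z ∈ P.1.support, z ∈ S}
    (fun P => weightedLength w P.1) (Set.toFinite _) ⟨_, key p₀ hp₀⟩
  exact ⟨P.1, hP, fun q hq => (hmin _ (key q hq)).trans (weightedLength_bypass_le q)⟩

/-- The distance to `t` inside `S`, with an unspecified value at the vertices that cannot be
connected to `t` inside `S`. -/
lemma exists_distTo [Finite V] (G : SimpleGraph V) (w : Sym2 V → ℝ≥0) (S : Set V) (t : V) :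
    ∃ g : V → ℝ≥0,
      (∀ x, (∃ p : G.Walk x t, ∀ z ∈ p.support, z ∈ S) →
        ∃ p : G.Walk x t, (∀ z ∈ p.support, z ∈ S) ∧ weightedLength w p = g x) ∧
      ∀ x (p : G.Walk x t), (∀ z ∈ p.support, z ∈ S) → g x ≤ weightedLength w p := by
  classical
  refine ⟨fun x => if h : ∃ p : G.Walk x t, ∀ z ∈ p.support, z ∈ S then
    weightedLength w (exists_shortest_walk (w := w) h).choose else 0, fun x h => ?_,
    fun x p hp => ?_⟩
  · exact ⟨_, (exists_shortest_walk (w := w) h).choose_spec.1, by simp only [dif_pos h]⟩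
  · have h : ∃ p : G.Walk x t, ∀ z ∈ p.support, z ∈ S := ⟨p, hp⟩
    simp only [dif_pos h]
    exact (exists_shortest_walk (w := w) h).choose_spec.2 p hp

/-- There is a walk from `x` to `y` inside `S` of length less than `ℓ`. -/
def Within (G : SimpleGraph V) (w : Sym2 V → ℝ≥0) (S : Set V) (x y : V) (ℓ : ℝ) : Prop :=
  ∃ p : G.Walk x y, (∀ z ∈ p.support, z ∈ S) ∧ (weightedLength w p : ℝ) < ℓ

namespace Within

variable {S T : Set V} {x y z : V} {ℓ ℓ' : ℝ}

lemma refl (hx : x ∈ S) (hℓ : 0 < ℓ) : Within G w S x x ℓ :=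
  ⟨.nil, by simpa using hx, by simpa using hℓ⟩

lemma symm (h : Within G w S x y ℓ) : Within G w S y x ℓ := by
  obtain ⟨p, hp, hl⟩ := h
  exact ⟨p.reverse, by simpa using hp, by simpa using hl⟩

lemma trans (h : Within G w S x y ℓ) (h' : Within G w S y z ℓ') :
    Within G w S x z (ℓ + ℓ') := by
  obtain ⟨p, hp, hl⟩ := h
  obtain ⟨q, hq, hl'⟩ := h'
  refine ⟨p.append q, fun a ha => ?_, ?_⟩
  · rcases (SimpleGraph.Walk.mem_support_append_iff _ _).1 ha with h | h
    exacts [hp a h, hq a h]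
  · push_cast [weightedLength_append]
    linarith

lemma mono (h : Within G w S x y ℓ) (hS : ∀ z ∈ S, z ∈ T) (hℓ : ℓ ≤ ℓ') :
    Within G w T x y ℓ' := by
  obtain ⟨p, hp, hl⟩ := h
  exact ⟨p, fun z hz => hS z (hp z hz), hl.trans_le hℓ⟩

end Within

/-- `x` and `y` are connected inside `S`. -/
def ConnIn (G : SimpleGraph V) (S : Set V) (x y : V) : Prop :=
  ∃ p : G.Walk x y, ∀ z ∈ p.support, z ∈ S

namespace ConnIn

variable {S T : Set V} {x y z : V}

lemma refl (hx : x ∈ S) : ConnIn G S x x := ⟨.nil, by simpa using hx⟩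

lemma symm (h : ConnIn G S x y) : ConnIn G S y x := by
  obtain ⟨p, hp⟩ := h
  exact ⟨p.reverse, by simpa using hp⟩

lemma trans (h : ConnIn G S x y) (h' : ConnIn G S y z) : ConnIn G S x z := by
  obtain ⟨p, hp⟩ := h
  obtain ⟨q, hq⟩ := h'
  refine ⟨p.append q, fun a ha => ?_⟩
  rcases (SimpleGraph.Walk.mem_support_append_iff _ _).1 ha with h | h
  exacts [hp a h, hq a h]

lemma mono (h : ConnIn G S x y) (hS : ∀ z ∈ S, z ∈ T) : ConnIn G T x y := by
  obtain ⟨p, hp⟩ := h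
  exact ⟨p, fun z hz => hS z (hp z hz)⟩

lemma left_mem (h : ConnIn G S x y) : x ∈ S := by
  obtain ⟨p, hp⟩ := h
  exact hp x p.start_mem_support

lemma right_mem (h : ConnIn G S x y) : y ∈ S := h.symm.left_mem

lemma of_adj (h : G.Adj x y) (hx : x ∈ S) (hy : y ∈ S) : ConnIn G S x y :=
  ⟨.cons h .nil, by simp [hx, hy]⟩

/-- A property that propagates along the edges inside `S` propagates along connections. -/
lemma induct {P : V → Prop} (hP : ∀ a b, a ∈ S → b ∈ S → G.Adj a b → P a → P b)
    (h : ConnIn G S x y) (hx : P x) : P y := by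
  obtain ⟨p, hp⟩ := h
  induction p with
  | nil => exact hx
  | cons hadj q ih =>
    refine ih (hP _ _ (hp _ (by simp)) (hp _ (by simp)) hadj hx) fun z hz => hp z (by simp [hz])

lemma of_mem_support {p : G.Walk x y} (hp : ∀ z ∈ p.support, z ∈ S) (hz : z ∈ p.support) :
    ConnIn G S x z := by
  classical
  exact ⟨p.takeUntil z hz, fun a ha => hp a (p.support_takeUntil_subset_support hz ha)⟩

end ConnIn

lemma Within.connIn {S : Set V} {x y : V} {ℓ : ℝ} (h : Within G w S x y ℓ) : ConnIn G S x y := by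
  obtain ⟨p, hp, -⟩ := h
  exact ⟨p, hp⟩

/-- A walk that leaves `H` has an initial segment that ends at its first vertex outside `H`. -/
lemma exists_exit {H : Set V} {x y : V} (p : G.Walk x y) (hx : x ∈ H) (hy : y ∉ H) :
    ∃ a ∈ H, ∃ b ∈ p.support, b ∉ H ∧ G.Adj a b ∧
      ∃ q : G.Walk x b, (∀ z ∈ q.support, z = b ∨ z ∈ H) ∧
        weightedLength w q ≤ weightedLength w p := by
  induction p with
  | nil => exact absurd hx hy
  | @cons u v y' hadj p ih =>
    by_cases hv : v ∈ H
    · obtain ⟨a, ha, b, hb, hbH, hab, q, hq, hl⟩ := ih hv hy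
      refine ⟨a, ha, b, by simp [hb], hbH, hab, .cons hadj q, ?_, by simpa using hl⟩
      intro z hz
      rcases List.mem_cons.1 (by simpa using hz) with rfl | hz
      exacts [Or.inr hx, hq z hz]
    · refine ⟨u, hx, v, by simp, hv, hadj, .cons hadj .nil, ?_, by simp⟩
      intro z hz
      simp at hz
      rcases hz with rfl | rfl
      exacts [Or.inr hx, Or.inl rfl]

/-! ### Voronoi cells and nets on shortest walks -/

/-- Voronoi assignment: the vertices of `K` that are close to the set `B` of sources can be
assigned to sources such that each is close to its source inside its own cell. -/
lemma exists_voronoi [Finite V] (G : SimpleGraph V) (w : Sym2 V → ℝ≥0) (K B : Set V) (D : ℝ) :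
    ∃ c : V → V, ∀ v ∈ K, (∃ b ∈ B, Within G w (insert b K) v b D) →
      c v ∈ B ∧ Within G w
        {u | (u ∈ K ∧ (∃ b ∈ B, Within G w (insert b K) u b D) ∧ c u = c v) ∨
          (u = c v ∧ u ∉ K)} v (c v) D := by
  classical
  have := Fintype.ofFinite V
  obtain ⟨e⟩ : Nonempty (V ↪ ℕ) := ⟨(Fintype.equivFin V).toEmbedding.trans Fin.valEmbedding⟩
  choose g hg₁ hg₂ using fun b => exists_distTo G w (insert b K) b
  let src : V → Finset V := fun v => {b | b ∈ B ∧ ConnIn G (insert b K) v b}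
  have hsrc : ∀ v b, b ∈ src v ↔ b ∈ B ∧ ConnIn G (insert b K) v b := by simp [src]
  -- Sources are compared by distance, then by an arbitrary injective index. This consistent
  -- tie-breaking keeps a shortest walk to the source inside the cell.
  have hex : ∀ v, ∃ c, (src v).Nonempty → c ∈ src v ∧
      ∀ b ∈ src v, toLex (g c v, e c) ≤ toLex (g b v, e b) := by
    intro v
    by_cases h : (src v).Nonempty
    · obtain ⟨c, hc, hmin⟩ := Finset.exists_min_image (src v) (fun b => toLex (g b v, e b)) h
      exact ⟨c, fun _ => ⟨hc, hmin⟩⟩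
    · exact ⟨v, fun h' => absurd h' h⟩
  choose c hc using hex
  -- Induction along a shortest walk to `b`, which is cut off on reaching `b` if `b` lies outside
  -- `K`.
  have key : ∀ v b (p : G.Walk v b), v ∈ K → b ∈ B → (∀ z ∈ p.support, z ∈ insert b K) →
      weightedLength w p = g b v → (weightedLength w p : ℝ) < D → c v = b →
      ∃ q : G.Walk v b, (∀ z ∈ q.support,
        (z ∈ K ∧ (∃ b ∈ B, Within G w (insert b K) z b D) ∧ c z = b) ∨ (z = b ∧ z ∉ K)) ∧
        weightedLength w q ≤ weightedLength w p := by
    intro v b p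
    induction p with
    | nil =>
      intro hv hb hp hl hD hcv
      refine ⟨.nil, fun z hz => ?_, le_rfl⟩
      obtain rfl : z = _ := by simpa using hz
      exact Or.inl ⟨hv, ⟨_, hb, .nil, hp, hD⟩, hcv⟩
    | @cons v v' b hadj p ih =>
      intro hv hb hp hl hD hcv
      have hv_cell : v ∈ K ∧ (∃ b ∈ B, Within G w (insert b K) v b D) ∧ c v = b :=
        ⟨hv, ⟨_, hb, .cons hadj p, hp, hD⟩, hcv⟩
      have hp' : ∀ z ∈ p.support, z ∈ insert b K := fun z hz => hp z (by simp [hz])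
      rw [weightedLength_cons] at hl
      have hstep : ∀ b', ∀ q : G.Walk v' b', (∀ z ∈ q.support, z ∈ insert b' K) →
          ∀ z ∈ (SimpleGraph.Walk.cons hadj q).support, z ∈ insert b' K := by
        intro b' q hq z hz
        rcases List.mem_cons.1 (by simpa using hz) with rfl | hz
        exacts [Or.inr hv, hq z hz]
      by_cases hv' : v' ∈ K
      · have h1 := hg₂ b v' p hp'
        obtain ⟨q, hq, hql⟩ := hg₁ b v' ⟨p, hp'⟩
        have h2 := hg₂ b v _ (hstep b q hq)
        rw [weightedLength_cons, hql] at h2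
        have hpl : weightedLength w p = g b v' := by
          refine le_antisymm ?_ h1
          rw [← hl] at h2
          exact le_of_add_le_add_left h2
        have hD' : (weightedLength w p : ℝ) < D := by
          refine lt_of_le_of_lt ?_ hD
          rw [weightedLength_cons]; push_cast
          linarith [(w s(v, v')).coe_nonneg]
        suffices hcv' : c v' = b by
          obtain ⟨q, hq, hql⟩ := ih hv' hb hp' hpl hD' hcv'
          refine ⟨.cons hadj q, fun z hz => ?_, by simpa using hql⟩
          rcases List.mem_cons.1 (by simpa using hz) with rfl | hz
          exacts [Or.inl hv_cell, hq z hz]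
        -- The source chosen at `v'` is no worse than `b` there. Through the edge to `v'` it is then
        -- no worse than `b` at `v` either, so minimality of `b` at `v` forces equality in both
        -- coordinates.
        have hbsrc' : b ∈ src v' := (hsrc _ _).2 ⟨hb, p, hp'⟩
        obtain ⟨hc1, hc2⟩ := hc v' ⟨b, hbsrc'⟩
        have hbsrc : b ∈ src v := (hsrc _ _).2 ⟨hb, .cons hadj p, hp⟩
        have hc3 := (hc v ⟨b, hbsrc⟩).2
        rw [hcv] at hc3
        obtain ⟨hcB, q', hq'⟩ := (hsrc _ _).1 hc1
        obtain ⟨q', hq', hql'⟩ := hg₁ (c v') v' ⟨q', hq'⟩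
        have h3 := hg₂ _ v _ (hstep _ q' hq')
        rw [weightedLength_cons, hql'] at h3
        have h4 := hc3 (c v') ((hsrc _ _).2 ⟨hcB, _, hstep _ q' hq'⟩)
        have h5 := hc2 b hbsrc'
        rw [Prod.Lex.toLex_le_toLex] at h4 h5
        rw [hpl] at hl
        apply e.injective
        rw [← hl] at h4
        simp only at h4 h5
        have h6 : g (c v') v' ≤ g b v' := by
          rcases h5 with h5 | h5
          exacts [h5.le, h5.1.le]
        have h7 : w s(v, v') + g b v' ≤ g (c v') v := by
          rcases h4 with h4 | h4
          exacts [h4.le, h4.1.le]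
        have h8 : g b v' = g (c v') v' :=
          le_antisymm (le_of_add_le_add_left (h7.trans h3)) h6
        rcases h5 with h5 | h5
        · exact absurd h8 h5.ne'
        rcases h4 with h4 | h4
        · rw [h8] at h4
          exact absurd h4 (not_lt.2 h3)
        exact le_antisymm h5.2 h4.2
      · have hv'b : v' = b := by
          rcases hp' v' p.start_mem_support with h | h
          exacts [h, absurd h hv']
        subst hv'b
        refine ⟨.cons hadj .nil, fun z hz => ?_, by simp⟩
        simp at hz
        rcases hz with rfl | rfl
        exacts [Or.inl hv_cell, Or.inr ⟨rfl, hv'⟩]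
  refine ⟨c, fun v hv hex => ?_⟩
  have hvs : (src v).Nonempty := by
    obtain ⟨b, hb, h⟩ := hex
    exact ⟨b, (hsrc _ _).2 ⟨hb, h.connIn⟩⟩
  obtain ⟨hcs, hmin⟩ := hc v hvs
  obtain ⟨hcB, hj⟩ := (hsrc _ _).1 hcs
  obtain ⟨p, hp, hl⟩ := hg₁ _ _ hj
  have hD : (weightedLength w p : ℝ) < D := by
    obtain ⟨b, hb, q, hq, hqD⟩ := hex
    have h1 := hmin b ((hsrc _ _).2 ⟨hb, q, hq⟩)
    rw [Prod.Lex.toLex_le_toLex] at h1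
    have h2 : g (c v) v ≤ g b v := by
      rcases h1 with h1 | h1
      exacts [h1.le, h1.1.le]
    rw [hl]
    exact lt_of_le_of_lt (by exact_mod_cast h2.trans (hg₂ b v q hq)) hqD
  obtain ⟨q, hq, hql⟩ := key v _ p hv hcB hp hl hD rfl
  exact ⟨hcB, q, hq, lt_of_le_of_lt (by exact_mod_cast hql) hD⟩

/-- The vertices of a shortest walk to `t` are covered by one centre for each interval
`[jΔ, (j+1)Δ)` of distances to `t`. -/
lemma exists_net_of_shortest_walk {S : Set V} {t : V} {g : V → ℝ≥0} {Δ : ℝ} (hΔ : 0 < Δ)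
    (hg' : ∀ x, (∃ p : G.Walk x t, ∀ z ∈ p.support, z ∈ S) →
      ∃ p : G.Walk x t, (∀ z ∈ p.support, z ∈ S) ∧ weightedLength w p = g x)
    (hg : ∀ x (p : G.Walk x t), (∀ z ∈ p.support, z ∈ S) → g x ≤ weightedLength w p)
    {b : V} (p : G.Walk b t) (hp : ∀ z ∈ p.support, z ∈ S) (hl : weightedLength w p = g b) :
    ∃ N : Finset V, (∀ c ∈ N, c ∈ p.support) ∧
      (∀ c ∈ N, ∀ c' ∈ N, ⌊(g c : ℝ) / Δ⌋₊ = ⌊(g c' : ℝ) / Δ⌋₊ → c = c') ∧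
      ∀ v ∈ p.support, ∃ c ∈ N, Within G w {z | z ∈ p.support} v c Δ := by
  classical
  -- For the induction, a vertex and its centre share an interval and are joined by a walk whose
  -- length is exactly the difference of their distances to `t`; that difference is below Δ.
  suffices h : ∃ N : Finset V, (∀ c ∈ N, c ∈ p.support) ∧
      (∀ c ∈ N, ∀ c' ∈ N, ⌊(g c : ℝ) / Δ⌋₊ = ⌊(g c' : ℝ) / Δ⌋₊ → c = c') ∧
      (∀ v ∈ p.support, g v ≤ g b) ∧
      ∀ v ∈ p.support, ∃ c ∈ N, ⌊(g c : ℝ) / Δ⌋₊ = ⌊(g v : ℝ) / Δ⌋₊ ∧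
        ∃ q : G.Walk v c, (∀ z ∈ q.support, z ∈ p.support) ∧
          weightedLength w q + g c = g v by
    obtain ⟨N, h1, h2, -, h3⟩ := h
    refine ⟨N, h1, h2, fun v hv => ?_⟩
    obtain ⟨c, hc, hk, q, hq, hql⟩ := h3 v hv
    refine ⟨c, hc, q, hq, ?_⟩
    have e1 := Nat.floor_le (a := (g c : ℝ) / Δ) (by positivity)
    have e2 := Nat.lt_floor_add_one ((g v : ℝ) / Δ)
    rw [hk, le_div_iff₀ hΔ] at e1
    rw [div_lt_iff₀ hΔ] at e2
    have e3 : (weightedLength w q : ℝ) + g c = g v := by exact_mod_cast hql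
    linarith
  induction p with
  | nil =>
    rename_i b
    refine ⟨{b}, by simp, by simp, by simp, fun v hv => ?_⟩
    obtain rfl : v = _ := by simpa using hv
    exact ⟨v, by simp, rfl, .nil, by simp, by simp⟩
  | @cons b a t hadj p ih =>
    have hp' : ∀ z ∈ p.support, z ∈ S := fun z hz => hp z (by simp [hz])
    have hbS : b ∈ S := hp b (by simp)
    rw [weightedLength_cons] at hl
    have hstep : ∀ q : G.Walk a t, (∀ z ∈ q.support, z ∈ S) →
        g b ≤ w s(b, a) + weightedLength w q := by
      intro q hq
      rw [← weightedLength_cons hadj]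
      refine hg b _ fun z hz => ?_
      rcases List.mem_cons.1 (by simpa using hz) with rfl | hz
      exacts [hbS, hq z hz]
    have hla : weightedLength w p = g a := by
      refine le_antisymm ?_ (hg a p hp')
      obtain ⟨q, hq, hql⟩ := hg' a ⟨p, hp'⟩
      have := hstep q hq
      rw [← hl, hql] at this
      exact le_of_add_le_add_left this
    obtain ⟨N, hN, hinj, hle, hcov⟩ := ih hg' hg hp' hla
    have hab : g a ≤ g b := by rw [← hl, hla]; exact le_add_self
    have hmono : ∀ v ∈ (SimpleGraph.Walk.cons hadj p).support, g v ≤ g b := by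
      intro v hv
      rcases List.mem_cons.1 (by simpa using hv) with rfl | hv
      exacts [le_rfl, (hle v hv).trans hab]
    have hold : ∀ v ∈ p.support, ∃ c ∈ N, ⌊(g c : ℝ) / Δ⌋₊ = ⌊(g v : ℝ) / Δ⌋₊ ∧
        ∃ q : G.Walk v c, (∀ z ∈ q.support, z ∈ (SimpleGraph.Walk.cons hadj p).support) ∧
          weightedLength w q + g c = g v := by
      intro v hv
      obtain ⟨c, hc, hk, q, hq, hql⟩ := hcov v hv
      exact ⟨c, hc, hk, q, fun z hz => by simp [hq z hz], hql⟩
    -- Going back from `t`, a vertex becomes a centre exactly when it enters a new interval.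
    by_cases hk : ⌊(g a : ℝ) / Δ⌋₊ = ⌊(g b : ℝ) / Δ⌋₊
    · refine ⟨N, fun c hc => by simp [hN c hc], hinj, hmono, fun v hv => ?_⟩
      rcases List.mem_cons.1 (by simpa using hv) with rfl | hv
      · obtain ⟨c, hc, hk', q, hq, hql⟩ := hold a p.start_mem_support
        refine ⟨c, hc, hk'.trans hk, .cons hadj q, fun z hz => ?_, ?_⟩
        · rcases List.mem_cons.1 (by simpa using hz) with rfl | hz
          exacts [by simp, hq z hz]
        · rw [weightedLength_cons, add_assoc, hql, ← hl, hla]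
      · exact hold v hv
    · have hlt : ∀ v ∈ p.support, ⌊(g v : ℝ) / Δ⌋₊ < ⌊(g b : ℝ) / Δ⌋₊ := by
        intro v hv
        have h1 : ⌊(g v : ℝ) / Δ⌋₊ ≤ ⌊(g a : ℝ) / Δ⌋₊ :=
          Nat.floor_mono (div_le_div_of_nonneg_right (by exact_mod_cast hle v hv) hΔ.le)
        have h2 : ⌊(g a : ℝ) / Δ⌋₊ ≤ ⌊(g b : ℝ) / Δ⌋₊ :=
          Nat.floor_mono (div_le_div_of_nonneg_right (by exact_mod_cast hab) hΔ.le)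
        omega
      refine ⟨insert b N, ?_, ?_, hmono, fun v hv => ?_⟩
      · intro c hc
        rcases Finset.mem_insert.1 hc with rfl | hc
        exacts [by simp, by simp [hN c hc]]
      · intro c hc c' hc' h
        rcases Finset.mem_insert.1 hc with h1 | h1 <;> rcases Finset.mem_insert.1 hc' with h2 | h2
        · exact h1.trans h2.symm
        · exact absurd h (by rw [h1]; exact (hlt c' (hN c' h2)).ne')
        · exact absurd h (by rw [h2]; exact (hlt c (hN c h1)).ne)
        · exact hinj c h1 c' h2 h
      · rcases List.mem_cons.1 (by simpa using hv) with rfl | hv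
        · exact ⟨v, by simp, rfl, .nil, by simp, by simp⟩
        · obtain ⟨c, hc, h⟩ := hold v hv
          exact ⟨c, by simp [hc], h⟩

end WalkLength

/-! ### The decomposition and its invariants -/

/-- A stage in the construction of a buffered cop decomposition. Supernodes are numbered in order
of creation; `node v` is the supernode of `v`, or `⊤` as long as `v` is unassigned. All vertices
`v` in a component of the unassigned part have the same set `live v` of supernodes that have not
been separated from it. For a supernode `Y`, `anc Y` is the set of supernodes that were live
when `Y` was created, `dom Y` is the component in which it was created and `net Y` is its set of
centres. -/
structure CopState {V : Type*} (G : SimpleGraph V) (w : Sym2 V → ℝ≥0) (r : ℕ) (Δ : ℝ) where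
  size : ℕ
  node : V → ℕ∞
  live : V → Finset ℕ
  anc : ℕ → Finset ℕ
  dom : ℕ → Set V
  net : ℕ → Finset V
  node_lt : ∀ v (Y : ℕ), node v = Y → Y < size
  live_lt : ∀ v, node v = ⊤ → ∀ Y ∈ live v, Y < size
  live_adj : ∀ u v, node u = ⊤ → node v = ⊤ → G.Adj u v → live u = live v
  mem_live : ∀ u v (Y : ℕ), node u = ⊤ → node v = Y → G.Adj u v → Y ∈ live u
  anc_lt : ∀ X Y, X ∈ anc Y → X < Y
  anc_chain : ∀ u, node u = ⊤ → ∀ X ∈ live u, ∀ Y ∈ live u, X < Y → X ∈ anc Y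
  anc_edge : ∀ Y < size, ∀ X ∈ anc Y, ∃ x y, node x = X ∧ node y = Y ∧ G.Adj x y
  anc_card : ∀ Y < size, (anc Y).card < r
  node_nonempty : ∀ Y < size, ∃ v, node v = Y
  node_conn : ∀ u v (Y : ℕ), node u = Y → node v = Y → ConnIn G {z | node z = Y} u v
  net_node : ∀ Y < size, ∀ c ∈ net Y, node c = Y
  -- The scale 5Δ will cover two distances below 2Δ from a vertex to its centre and one short walk.
  net_card : ∀ Y < size, ∀ M ⊆ net Y,
    (∀ a ∈ M, ∀ b ∈ M, Within G w (dom Y) a b (5 * Δ)) → M.card ≤ 6 * r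
  radius : ∀ v (Y : ℕ), node v = Y → ∃ c ∈ net Y, Within G w {z | node z = Y} v c (2 * Δ)
  -- The growth budget: each live supernode older than `Y` may still cost `Y` one layer of width
  -- Δ/r.
  radius_boundary : ∀ u v (Y : ℕ), node u = ⊤ → node v = Y → G.Adj u v →
    ∃ c ∈ net Y, Within G w {z | node z = Y} v c
      (Δ + Δ / r * (r - ((live u).filter (· < Y)).card))
  node_dom : ∀ v (Y : ℕ), node v = Y → v ∈ dom Y
  dom_closed : ∀ Y < size, ∀ u v, u ∈ dom Y → G.Adj u v → (Y : ℕ∞) ≤ node v → v ∈ dom Y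
  -- `u` ranges over all vertices that belong to `X` or could still join it. This set and the region
  -- of numbers at least `X` only shrink once `X` exists, so a separation persists.
  buffer_unassigned : ∀ v (X : ℕ), node v = ⊤ → X ∉ live v →
    ∀ u, (node u = X ∨ (node u = ⊤ ∧ X ∈ live u)) →
      ¬ Within G w {z | (X : ℕ∞) ≤ node z} v u (Δ / r)
  buffer : ∀ v (X Y : ℕ), node v = Y → X < Y → X ∉ anc Y →
    ∀ u, (node u = X ∨ (node u = ⊤ ∧ X ∈ live u)) →
      ¬ Within G w {z | (X : ℕ∞) ≤ node z} v u (Δ / r)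

namespace CopState

variable {V : Type*} {G : SimpleGraph V} {w : Sym2 V → ℝ≥0} {r : ℕ} {Δ : ℝ}

/-- The initial stage, in which all vertices are unassigned. -/
def initial (G : SimpleGraph V) (w : Sym2 V → ℝ≥0) (r : ℕ) (Δ : ℝ) : CopState G w r Δ where
  size := 0
  node _ := ⊤
  live _ := ∅
  anc _ := ∅
  dom _ := ∅
  net _ := ∅
  node_lt := by simp
  live_lt := by simp
  live_adj := by simp
  mem_live := by simp
  anc_lt := by simp
  anc_chain := by simp
  anc_edge := by simp
  anc_card := by simp
  node_nonempty := by simp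
  node_conn := by simp
  net_node := by simp
  net_card := by simp
  radius := by simp
  radius_boundary := by simp
  node_dom := by simp
  dom_closed := by simp
  buffer_unassigned := by simp
  buffer := by simp

/-- The component of `u` in the unassigned part. -/
def comp (σ : CopState G w r Δ) (u : V) : Set V := {v | ConnIn G {z | σ.node z = ⊤} u v}

variable (σ : CopState G w r Δ) {u : V}

lemma node_of_mem_comp {v : V} (hv : v ∈ σ.comp u) : σ.node v = ⊤ :=
  ConnIn.right_mem (S := {z | σ.node z = ⊤}) hv

lemma mem_comp_of_adj {a b : V} (ha : a ∈ σ.comp u) (hb : σ.node b = ⊤) (hab : G.Adj a b) :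
    b ∈ σ.comp u :=
  ConnIn.trans ha (.of_adj hab (σ.node_of_mem_comp ha) hb)

lemma live_eq_of_mem_comp {v : V} (hv : v ∈ σ.comp u) : σ.live v = σ.live u :=
  ConnIn.induct (P := fun x => σ.live x = σ.live u)
    (fun a b ha hb hab h => (σ.live_adj a b ha hb hab).symm.trans h) hv rfl

/-- Keeps the growth of `Y`, and later the short walks whose earliest supernode is `Y`, inside the
component in which the net of `Y` was chosen. -/
lemma mem_dom_of_connIn {Y : ℕ} (hY : Y < σ.size) {a b : V}
    (h : ConnIn G {z | (Y : ℕ∞) ≤ σ.node z} a b) (ha : a ∈ σ.dom Y) : b ∈ σ.dom Y :=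
  h.induct (P := fun x => x ∈ σ.dom Y)
    (fun _ _ _ hb hab h => σ.dom_closed Y hY _ _ h hab hb) ha

/-- The live supernodes of a component are pairwise adjacent, which bounds their number. -/
lemma card_live_lt (hG : CompleteMinorFree r G) (hu : σ.node u = ⊤) :
    (σ.live u).card < r := by
  by_contra! hcard
  apply hG
  obtain ⟨T, hT, hTr⟩ := Finset.exists_subset_card_eq hcard
  let e : Fin r ≃ T := (T.equivFinOfCardEq hTr).symm
  have hmem : ∀ i, (e i : ℕ) ∈ σ.live u := fun i => hT (e i).2
  have hlt : ∀ i, (e i : ℕ) < σ.size := fun i => σ.live_lt u hu _ (hmem i)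
  refine ⟨fun i => {z | σ.node z = ((e i : ℕ) : ℕ∞)}, fun i => ?_, fun i j hij => ?_,
    fun i j hij => ?_⟩
  · obtain ⟨v, hv⟩ := σ.node_nonempty _ (hlt i)
    have : Nonempty {z | σ.node z = ((e i : ℕ) : ℕ∞)} := ⟨⟨v, hv⟩⟩
    refine SimpleGraph.Connected.mk fun a b => ?_
    obtain ⟨p, hp⟩ := σ.node_conn a.1 b.1 _ a.2 b.2
    exact ⟨p.induce _ hp⟩
  · rw [Set.disjoint_left]
    intro z hz hz'
    apply hij
    have : ((e i : ℕ) : ℕ∞) = ((e j : ℕ) : ℕ∞) := (Eq.symm hz).trans hz'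
    exact e.injective (Subtype.ext (by exact_mod_cast this))
  · have hne : (e i : ℕ) ≠ e j := fun h => hij.ne (e.injective (Subtype.ext h))
    rcases lt_or_gt_of_ne hne with h | h
    · obtain ⟨x, y, hx, hy, hxy⟩ := σ.anc_edge _ (hlt j) _
        (σ.anc_chain u hu _ (hmem i) _ (hmem j) h)
      exact ⟨x, hx, y, hy, hxy⟩
    · obtain ⟨x, y, hx, hy, hxy⟩ := σ.anc_edge _ (hlt i) _
        (σ.anc_chain u hu _ (hmem j) _ (hmem i) h)
      exact ⟨y, hy, x, hx, hxy.symm⟩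

open Classical in
/-- The number of unassigned vertices. -/
noncomputable def rest [Fintype V] : ℕ := (Finset.univ.filter fun v => σ.node v = ⊤).card

/-! ### Growing supernodes to form a buffer -/

set_option maxHeartbeats 400000 in
/-- If a live supernode `X` of a component is not adjacent to it any more, then the part of the
component that is close to its boundary below `X` is assigned, and `X` is no longer live. -/
lemma exists_grow [Fintype V] (hr : 1 ≤ r) (hΔ : 0 < Δ) (u : V) (hu : σ.node u = ⊤) (X : ℕ)
    (hX : X ∈ σ.live u) (hXadj : ∀ a ∈ σ.comp u, ∀ b, G.Adj a b → σ.node b ≠ X) :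
    ∃ σ' : CopState G w r Δ, σ'.rest ≤ σ.rest ∧
      ∑ v, (σ'.live v).card < ∑ v, (σ.live v).card := by
  classical
  have hr0 : (0 : ℝ) < r := by exact_mod_cast hr
  have hγ : 0 < Δ / r := by positivity
  set H := σ.comp u with hH
  have huH : u ∈ H := ConnIn.refl hu
  let B : Set V := {b | σ.node b ≠ ⊤ ∧ (X : ℕ∞) < σ.node b ∧ ∃ a ∈ H, G.Adj a b}
  obtain ⟨c, hc⟩ := exists_voronoi G w H B (Δ / r)
  let R : V → Prop := fun v => v ∈ H ∧ ∃ b ∈ B, Within G w (insert b H) v b (Δ / r)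
  let node' : V → ℕ∞ := fun v => if R v then σ.node (c v) else σ.node v
  let live' : V → Finset ℕ := fun v => if v ∈ H then (σ.live v).erase X else σ.live v
  have hRH : ∀ v, R v → v ∈ H := fun v hv => hv.1
  have hHtop : ∀ v ∈ H, σ.node v = ⊤ := fun v hv => σ.node_of_mem_comp hv
  have hHlive : ∀ v ∈ H, σ.live v = σ.live u := fun v hv => σ.live_eq_of_mem_comp hv
  have hBprop : ∀ b ∈ B, ∃ Y : ℕ, σ.node b = Y ∧ X < Y ∧ Y ∈ σ.live u := by
    rintro b ⟨hb, hXb, a, ha, hab⟩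
    obtain ⟨Y, hY⟩ := ENat.ne_top_iff_exists.1 hb
    refine ⟨Y, hY.symm, by rw [← hY] at hXb; exact_mod_cast hXb, ?_⟩
    rw [← hHlive a ha]
    exact σ.mem_live a b Y (hHtop a ha) hY.symm hab
  have hcB : ∀ v, R v → c v ∈ B := fun v hv => (hc v hv.1 hv.2).1
  have hnode_R : ∀ v, R v → node' v = σ.node (c v) := fun v hv => if_pos hv
  have hnode_nR : ∀ v, ¬ R v → node' v = σ.node v := fun v hv => if_neg hv
  have hnode_old : ∀ v (Y : ℕ), σ.node v = Y → node' v = Y := by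
    intro v Y hv
    rw [hnode_nR v, hv]
    intro hR
    rw [hHtop v (hRH v hR)] at hv
    exact absurd hv.symm (ENat.natCast_ne_top Y)
  have hnode_top : ∀ v, node' v = ⊤ → σ.node v = ⊤ ∧ ¬ R v := by
    intro v hv
    by_cases hR : R v
    · rw [hnode_R v hR] at hv
      exact absurd hv (hcB v hR).1
    · exact ⟨(hnode_nR v hR).symm.trans hv, hR⟩
  have hnode_cases : ∀ v (Y : ℕ), node' v = Y → σ.node v = Y ∨
      (R v ∧ σ.node (c v) = Y ∧ X < Y ∧ Y ∈ σ.live u) := by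
    intro v Y hv
    by_cases hR : R v
    · right
      obtain ⟨Y', hY', h1, h2⟩ := hBprop _ (hcB v hR)
      rw [hnode_R v hR, hY'] at hv
      obtain rfl : Y' = Y := by exact_mod_cast hv
      exact ⟨hR, hY', h1, h2⟩
    · exact Or.inl ((hnode_nR v hR).symm.trans hv)
  have hnode_le : ∀ v, node' v ≤ σ.node v := by
    intro v
    by_cases hR : R v
    · rw [hHtop v (hRH v hR)]; exact le_top
    · rw [hnode_nR v hR]
  have hlive_in : ∀ v ∈ H, live' v = (σ.live v).erase X := fun v hv => if_pos hv
  have hlive_out : ∀ v ∉ H, live' v = σ.live v := fun v hv => if_neg hv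
  have hlive_sub : ∀ v, live' v ⊆ σ.live v := by
    intro v
    by_cases hv : v ∈ H
    · rw [hlive_in v hv]; exact Finset.erase_subset _ _
    · rw [hlive_out v hv]
  have hpot : ∀ (Z : ℕ) v, (node' v = Z ∨ (node' v = ⊤ ∧ Z ∈ live' v)) →
      (σ.node v = Z ∨ (σ.node v = ⊤ ∧ Z ∈ σ.live v)) := by
    rintro Z v (h | ⟨h, h'⟩)
    · rcases hnode_cases v Z h with h | ⟨hR, -, -, hZ⟩
      · exact Or.inl h
      · exact Or.inr ⟨hHtop v (hRH v hR), by rw [hHlive v (hRH v hR)]; exact hZ⟩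
    · exact Or.inr ⟨(hnode_top v h).1, hlive_sub v h'⟩
  have hcell : ∀ v (Y : ℕ), R v → σ.node (c v) = Y →
      Within G w {z | node' z = Y} v (c v) (Δ / r) := by
    intro v Y hR hY
    refine (hc v hR.1 hR.2).2.mono ?_ le_rfl
    rintro z (⟨h1, h2, h3⟩ | ⟨rfl, -⟩)
    · have : R z := ⟨h1, h2⟩
      change node' z = Y
      rw [hnode_R z this, h3, hY]
    · exact hnode_old _ _ hY
  have hclass : ∀ Y : ℕ, ∀ z ∈ {z | σ.node z = (Y : ℕ∞)}, z ∈ {z | node' z = (Y : ℕ∞)} :=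
    fun Y z hz => hnode_old z Y hz
  have hup : ∀ Z : ℕ, ∀ z ∈ {z | (Z : ℕ∞) ≤ node' z}, z ∈ {z | (Z : ℕ∞) ≤ σ.node z} :=
    fun Z z hz => le_trans (α := ℕ∞) hz (hnode_le z)
  have hroot : ∀ v (Y : ℕ), node' v = Y → ∃ v₀, σ.node v₀ = Y ∧
      ConnIn G {z | node' z = (Y : ℕ∞)} v v₀ := by
    intro v Y hv
    rcases hnode_cases v Y hv with h | ⟨hR, hcY, -, -⟩
    · exact ⟨v, h, .refl hv⟩
    · exact ⟨c v, hcY, (hcell v Y hR hcY).connIn⟩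
  -- Since `X` is live and `X < Y`, erasing it lowers the count by one, which pays for the new layer
  -- of width Δ/r.
  have hradR : ∀ v (Y : ℕ), R v → σ.node (c v) = Y → ∃ x ∈ σ.net Y,
      Within G w {z | node' z = Y} v x
        (Δ + Δ / r * (r - (((σ.live u).erase X).filter (· < Y)).card)) := by
    intro v Y hR hY
    obtain ⟨-, hXc, a, ha, hac⟩ := hcB v hR
    obtain ⟨x, hx, hxw⟩ := σ.radius_boundary a (c v) Y (hHtop a ha) hY hac
    refine ⟨x, hx, ((hcell v Y hR hY).trans (hxw.mono (hclass Y) le_rfl)).mono (fun z h => h) ?_⟩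
    rw [hHlive a ha]
    have hXY : X < Y := by rw [hY] at hXc; exact_mod_cast hXc
    have hcard : (((σ.live u).erase X).filter (· < Y)).card + 1 =
        ((σ.live u).filter (· < Y)).card := by
      rw [Finset.filter_erase]
      exact Finset.card_erase_add_one (Finset.mem_filter.2 ⟨hX, hXY⟩)
    rw [← hcard]
    push_cast
    linarith
  let σ' : CopState G w r Δ :=
    { size := σ.size
      node := node'
      live := live'
      anc := σ.anc
      dom := σ.dom
      net := σ.net
      node_lt := by
        intro v Y hv
        rcases hnode_cases v Y hv with h | ⟨-, h, -⟩ <;> exact σ.node_lt _ _ h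
      live_lt := fun v hv Y hY => σ.live_lt v (hnode_top v hv).1 Y (hlive_sub v hY)
      live_adj := by
        intro a b ha hb hab
        have ha' := (hnode_top a ha).1
        have hb' := (hnode_top b hb).1
        have hiff : a ∈ H ↔ b ∈ H :=
          ⟨fun h => σ.mem_comp_of_adj h hb' hab, fun h => σ.mem_comp_of_adj h ha' hab.symm⟩
        have := σ.live_adj a b ha' hb' hab
        by_cases haH : a ∈ H
        · rw [hlive_in a haH, hlive_in b (hiff.1 haH), this]
        · rw [hlive_out a haH, hlive_out b (fun h => haH (hiff.2 h)), this]
      mem_live := by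
        intro a b Y ha hb hab
        have ha' := (hnode_top a ha).1
        have haY : Y ∈ σ.live a ∧ (a ∈ H → Y ≠ X) := by
          rcases hnode_cases b Y hb with h | ⟨hR, -, hXY, hY⟩
          · refine ⟨σ.mem_live a b Y ha' h hab, fun haH hYX => ?_⟩
            subst hYX
            exact hXadj a haH b hab h
          · have haH := σ.mem_comp_of_adj (hRH b hR) ha' hab.symm
            exact ⟨by rw [hHlive a haH]; exact hY, fun _ => hXY.ne'⟩
        by_cases haH : a ∈ H
        · rw [hlive_in a haH]
          exact Finset.mem_erase.2 ⟨haY.2 haH, haY.1⟩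
        · rw [hlive_out a haH]
          exact haY.1
      anc_lt := σ.anc_lt
      anc_chain := fun a ha Y hY Z hZ h =>
        σ.anc_chain a (hnode_top a ha).1 Y (hlive_sub a hY) Z (hlive_sub a hZ) h
      anc_edge := by
        intro Y hY Z hZ
        obtain ⟨x, y, hx, hy, hxy⟩ := σ.anc_edge Y hY Z hZ
        exact ⟨x, y, hnode_old _ _ hx, hnode_old _ _ hy, hxy⟩
      anc_card := σ.anc_card
      node_nonempty := fun Y hY => (σ.node_nonempty Y hY).imp fun v hv => hnode_old _ _ hv
      node_conn := by
        intro a b Y ha hb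
        obtain ⟨a', ha', haa'⟩ := hroot a Y ha
        obtain ⟨b', hb', hbb'⟩ := hroot b Y hb
        exact (haa'.trans ((σ.node_conn a' b' Y ha' hb').mono (hclass Y))).trans hbb'.symm
      net_node := fun Y hY x hx => hnode_old _ _ (σ.net_node Y hY x hx)
      net_card := σ.net_card
      radius := by
        intro v Y hv
        rcases hnode_cases v Y hv with h | ⟨hR, hcY, -⟩
        · obtain ⟨x, hx, hxw⟩ := σ.radius v Y h
          exact ⟨x, hx, hxw.mono (hclass Y) le_rfl⟩
        · obtain ⟨x, hx, hxw⟩ := hradR v Y hR hcY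
          refine ⟨x, hx, hxw.mono (fun _ h => h) ?_⟩
          have : Δ / r * r = Δ := div_mul_cancel₀ _ hr0.ne'
          have h2 : 0 ≤ Δ / r * (((σ.live u).erase X).filter (· < Y)).card :=
            mul_nonneg hγ.le (Nat.cast_nonneg _)
          linarith
      radius_boundary := by
        intro a v Y ha hv hav
        have ha' := (hnode_top a ha).1
        rcases hnode_cases v Y hv with h | ⟨hR, hcY, -⟩
        · obtain ⟨x, hx, hxw⟩ := σ.radius_boundary a v Y ha' h hav
          refine ⟨x, hx, hxw.mono (hclass Y) ?_⟩
          have hle : (((live' a).filter (· < Y)).card : ℝ) ≤ ((σ.live a).filter (· < Y)).card := by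
            exact_mod_cast Finset.card_le_card (Finset.filter_subset_filter _ (hlive_sub a))
          have := mul_le_mul_of_nonneg_left hle hγ.le
          linarith
        · obtain ⟨x, hx, hxw⟩ := hradR v Y hR hcY
          have haH := σ.mem_comp_of_adj (hRH v hR) ha' hav.symm
          refine ⟨x, hx, ?_⟩
          rw [hlive_in a haH]
          rw [hHlive a haH]
          exact hxw
      node_dom := by
        intro v Y hv
        rcases hnode_cases v Y hv with h | ⟨hR, hcY, -⟩
        · exact σ.node_dom v Y h
        · refine σ.mem_dom_of_connIn (σ.node_lt _ _ hcY) (a := c v) ?_ (σ.node_dom _ _ hcY)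
          refine (hcell v Y hR hcY).connIn.symm.mono fun z hz => ?_
          exact le_trans (le_of_eq (Eq.symm hz)) (hnode_le z)
      dom_closed := fun Y hY a b ha hab hb =>
        σ.dom_closed Y hY a b ha hab (hb.trans (hnode_le b))
      buffer_unassigned := by
        intro v Z hv hZ x hx hw
        obtain ⟨hv', hvR⟩ := hnode_top v hv
        by_cases hZv : Z ∈ σ.live v
        swap
        · exact σ.buffer_unassigned v Z hv' hZv x (hpot Z x hx) (hw.mono (hup Z) le_rfl)
        by_cases hvH : v ∈ H
        swap
        · exact hZ (by rw [hlive_out v hvH]; exact hZv)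
        obtain rfl : Z = X := by
          by_contra hne
          exact hZ (by rw [hlive_in v hvH]; exact Finset.mem_erase.2 ⟨hne, hZv⟩)
        have hxH : x ∉ H := by
          intro hxH
          rcases hx with hx | ⟨hx, hx'⟩
          · rcases hnode_cases x Z hx with h | ⟨-, -, h, -⟩
            · rw [hHtop x hxH] at h
              exact ENat.top_ne_natCast _ h
            · exact lt_irrefl _ h
          · rw [hlive_in x hxH] at hx'
            exact Finset.notMem_erase _ _ hx'
        -- The walk leaves `H` at an assigned vertex `b` of number at least `X`, and not `X` by
        -- `hXadj`. Hence `b ∈ B`, and `v` would have been absorbed.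
        obtain ⟨p, hp, hpl⟩ := hw
        obtain ⟨a, ha, b, hb, hbH, hab, q, hq, hql⟩ := exists_exit (w := w) p hvH hxH
        have hbtop : σ.node b ≠ ⊤ := fun h => hbH (σ.mem_comp_of_adj ha h hab)
        have hbge : (Z : ℕ∞) ≤ σ.node b := hup Z b (hp b hb)
        refine hvR ⟨hvH, b, ⟨hbtop, lt_of_le_of_ne hbge (hXadj a ha b hab).symm, a, ha, hab⟩,
          q, hq, lt_of_le_of_lt (by exact_mod_cast hql) hpl⟩
      buffer := by
        intro v Z Y hv hZY hZ x hx hw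
        rcases hnode_cases v Y hv with h | ⟨hR, hcY, hXY, hY⟩
        · exact σ.buffer v Z Y h hZY hZ x (hpot Z x hx) (hw.mono (hup Z) le_rfl)
        -- Live supernodes older than `Y` are ancestors of `Y`. A non-ancestor `Z` was therefore not
        -- live at `v`, and its buffer already existed before `v` was absorbed.
        · refine σ.buffer_unassigned v Z (hHtop v (hRH v hR)) (fun hZv => hZ ?_) x (hpot Z x hx)
            (hw.mono (hup Z) le_rfl)
          rw [hHlive v (hRH v hR)] at hZv
          exact σ.anc_chain u hu Z hZv Y hY hZY }
  refine ⟨σ', ?_, ?_⟩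
  · refine Finset.card_le_card fun v hv => ?_
    simp only [Finset.mem_filter, Finset.mem_univ, true_and] at hv ⊢
    exact (hnode_top v hv).1
  · refine Finset.sum_lt_sum (fun v _ => Finset.card_le_card (hlive_sub v))
      ⟨u, Finset.mem_univ u, Finset.card_lt_card ?_⟩
    change live' u ⊂ σ.live u
    rw [hlive_in u huH]
    exact Finset.erase_ssubset hX

end CopState

/-! ### Skeletons of shortest walks -/

/-- A connected set of vertices consisting of shortest walks in `H` to a common root `t`,
together with a set of centres only few of which are close to each other. -/
lemma exists_skeleton {V : Type*} [Finite V] (G : SimpleGraph V) (w : Sym2 V → ℝ≥0) {r : ℕ}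
    {Δ : ℝ} (hΔ : 0 < Δ) {ι : Type*} (I : Finset ι) (hI : I.card < r) (H : Set V) (t : V)
    (ht : t ∈ H) (h : ι → V) (hh : ∀ i ∈ I, ConnIn G H (h i) t) :
    ∃ (T : Set V) (N : Finset V), T ⊆ H ∧ t ∈ T ∧ (∀ i ∈ I, h i ∈ T) ∧
      (∀ v ∈ T, ConnIn G T v t) ∧ (∀ c ∈ N, c ∈ T) ∧ (∀ v ∈ T, ∃ c ∈ N, Within G w T v c Δ) ∧
      ∀ M ⊆ N, (∀ a ∈ M, ∀ b ∈ M, Within G w H a b (5 * Δ)) → M.card ≤ 6 * r := by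
  classical
  obtain ⟨g, hg', hg⟩ := exists_distTo G w H t
  have hwalk : ∀ i : I, ∃ p : G.Walk (h i) t, (∀ z ∈ p.support, z ∈ H) ∧
      ∃ N : Finset V, (∀ c ∈ N, c ∈ p.support) ∧
      (∀ c ∈ N, ∀ c' ∈ N, ⌊(g c : ℝ) / Δ⌋₊ = ⌊(g c' : ℝ) / Δ⌋₊ → c = c') ∧
      ∀ v ∈ p.support, ∃ c ∈ N, Within G w {z | z ∈ p.support} v c Δ := by
    intro i
    obtain ⟨p, hp, hl⟩ := hg' _ (hh i i.2)
    exact ⟨p, hp, exists_net_of_shortest_walk hΔ hg' hg p hp hl⟩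
  choose p hpH N hNp hNinj hNcov using hwalk
  let T : Set V := {z | z = t ∨ ∃ i, z ∈ (p i).support}
  have hT : ∀ i, ∀ z ∈ (p i).support, z ∈ T := fun i z hz => Or.inr ⟨i, hz⟩
  let k : V → ℕ := fun c => ⌊(g c : ℝ) / Δ⌋₊
  refine ⟨T, insert t (Finset.univ.biUnion N), ?_, Or.inl rfl,
    fun i hi => hT ⟨i, hi⟩ _ (p ⟨i, hi⟩).start_mem_support, ?_, ?_, ?_, ?_⟩
  · rintro z (rfl | ⟨i, hz⟩)
    exacts [ht, hpH i z hz]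
  · rintro z (rfl | ⟨i, hz⟩)
    · exact .refl (Or.inl rfl)
    · exact (ConnIn.of_mem_support (hT i) hz).symm.trans ⟨p i, hT i⟩
  · intro c hc
    rcases Finset.mem_insert.1 hc with rfl | hc
    · exact Or.inl rfl
    · obtain ⟨i, -, hc⟩ := Finset.mem_biUnion.1 hc
      exact hT i c (hNp i c hc)
  · rintro v (rfl | ⟨i, hv⟩)
    · exact ⟨v, Finset.mem_insert_self _ _, .refl (Or.inl rfl) hΔ⟩
    · obtain ⟨c, hc, hvc⟩ := hNcov i v hv
      exact ⟨c, Finset.mem_insert_of_mem (Finset.mem_biUnion.2 ⟨i, Finset.mem_univ _, hc⟩),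
        hvc.mono (hT i) le_rfl⟩
  · intro M hM hclose
    rcases M.eq_empty_or_nonempty with rfl | hne
    · simp
    -- One interval contains at most one centre from each of fewer than r walks, plus the root.
    have hfib : ∀ j, (M.filter fun c => k c = j).card ≤ r := by
      intro j
      calc (M.filter fun c => k c = j).card
          ≤ (insert t (Finset.univ.biUnion fun i => (N i).filter fun c => k c = j)).card := by
            refine Finset.card_le_card fun c hc => ?_
            obtain ⟨hcM, hcj⟩ := Finset.mem_filter.1 hc
            rcases Finset.mem_insert.1 (hM hcM) with rfl | hc
            · exact Finset.mem_insert_self _ _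
            · obtain ⟨i, hi, hc⟩ := Finset.mem_biUnion.1 hc
              exact Finset.mem_insert_of_mem
                (Finset.mem_biUnion.2 ⟨i, hi, Finset.mem_filter.2 ⟨hc, hcj⟩⟩)
        _ ≤ (Finset.univ.biUnion fun i => (N i).filter fun c => k c = j).card + 1 :=
            Finset.card_insert_le _ _
        _ ≤ (∑ i : I, ((N i).filter fun c => k c = j).card) + 1 :=
            Nat.succ_le_succ Finset.card_biUnion_le
        _ ≤ (∑ _i : I, 1) + 1 := by
            refine Nat.succ_le_succ (Finset.sum_le_sum fun i _ => Finset.card_le_one.2 ?_)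
            intro a ha b hb
            rw [Finset.mem_filter] at ha hb
            exact hNinj i a ha.1 b hb.1 (ha.2.trans hb.2.symm)
        _ ≤ r := by simpa using hI
    -- Distance to `t` is 1-Lipschitz inside `H`, so centres within 5Δ of each other span at most
    -- six intervals.
    have hlip : ∀ a ∈ M, ∀ b ∈ M, k a ≤ k b + 5 := by
      intro a ha b hb
      obtain ⟨q, hq, hql⟩ := hclose a ha b hb
      have hbt : ∃ q' : G.Walk b t, (∀ z ∈ q'.support, z ∈ H) ∧ weightedLength w q' = g b := by
        apply hg'
        rcases Finset.mem_insert.1 (hM hb) with rfl | hb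
        · exact ConnIn.refl ht
        · obtain ⟨i, -, hb⟩ := Finset.mem_biUnion.1 hb
          exact (ConnIn.of_mem_support (hpH i) (hNp i b hb)).symm.trans ⟨p i, hpH i⟩
      obtain ⟨q', hq', hql'⟩ := hbt
      have h1 := hg a (q.append q') fun z hz => by
        rcases (SimpleGraph.Walk.mem_support_append_iff _ _).1 hz with h | h
        exacts [hq z h, hq' z h]
      rw [weightedLength_append, hql'] at h1
      have h2 : (g a : ℝ) ≤ weightedLength w q + g b := by exact_mod_cast h1
      have h3 : (g a : ℝ) / Δ ≤ (g b : ℝ) / Δ + (5 : ℕ) := by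
        rw [div_add' _ _ _ hΔ.ne']
        refine div_le_div_of_nonneg_right ?_ hΔ.le
        push_cast
        linarith
      calc k a ≤ ⌊(g b : ℝ) / Δ + (5 : ℕ)⌋₊ := Nat.floor_mono h3
        _ = k b + 5 := Nat.floor_add_natCast (by positivity) 5
    obtain ⟨a₀, ha₀, hmin⟩ := Finset.exists_min_image M k hne
    have himg : M.image k ⊆ Finset.Icc (k a₀) (k a₀ + 5) := by
      intro j hj
      obtain ⟨a, ha, rfl⟩ := Finset.mem_image.1 hj
      exact Finset.mem_Icc.2 ⟨hmin a ha, hlip a ha a₀ ha₀⟩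
    calc M.card ≤ r * (M.image k).card :=
          Finset.card_le_mul_card_image M r fun j _ => hfib j
      _ ≤ r * 6 := by
          refine Nat.mul_le_mul_left r ((Finset.card_le_card himg).trans ?_)
          simp
          omega
      _ = 6 * r := mul_comm _ _

/-! ### Creating supernodes, and termination -/

namespace CopState

variable {V : Type*} {G : SimpleGraph V} {w : Sym2 V → ℝ≥0} {r : ℕ} {Δ : ℝ}
  (σ : CopState G w r Δ)

set_option maxHeartbeats 400000 in
/-- If all live supernodes of a component are adjacent to it, a new supernode is created. -/
lemma exists_create [Fintype V] (hG : CompleteMinorFree r G) (hΔ : 0 < Δ) (u : V)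
    (hu : σ.node u = ⊤)
    (hadj : ∀ X ∈ σ.live u, ∃ a ∈ σ.comp u, ∃ b, G.Adj a b ∧ σ.node b = X) :
    ∃ σ' : CopState G w r Δ, σ'.rest < σ.rest := by
  classical
  have hcard := σ.card_live_lt hG hu
  have hr0 : (0 : ℝ) < r := by exact_mod_cast (Nat.zero_le _).trans_lt hcard
  have hγ : 0 < Δ / r := by positivity
  set H := σ.comp u with hH
  have huH : u ∈ H := ConnIn.refl hu
  have hHtop : ∀ v ∈ H, σ.node v = ⊤ := fun v hv => σ.node_of_mem_comp hv
  have hHlive : ∀ v ∈ H, σ.live v = σ.live u := fun v hv => σ.live_eq_of_mem_comp hv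
  have hHconn : ∀ v ∈ H, ConnIn G H v u := by
    intro v hv
    obtain ⟨p, hp⟩ := ConnIn.symm hv
    refine ⟨p, fun z hz => ?_⟩
    exact ConnIn.trans hv (ConnIn.of_mem_support hp hz)
  have : Nonempty V := ⟨u⟩
  -- The skeleton will contain `h X` for every live `X`, so the new supernode is adjacent to all its
  -- ancestors.
  choose! h hhH hb hadj hbnode using hadj
  obtain ⟨T, N, hTH, huT, hhT, hTconn, hNT, hNcov, hNcard⟩ :=
    exists_skeleton G w hΔ (σ.live u) hcard H u huH h fun X hX => hHconn _ (hhH X hX)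
  set n := σ.size with hn
  let node' : V → ℕ∞ := fun v => if v ∈ T then (n : ℕ∞) else σ.node v
  let live' : V → Finset ℕ := fun v => if v ∈ H then insert n (σ.live v) else σ.live v
  let anc' : ℕ → Finset ℕ := fun Y => if Y = n then σ.live u else σ.anc Y
  let dom' : ℕ → Set V := fun Y => if Y = n then H else σ.dom Y
  let net' : ℕ → Finset V := fun Y => if Y = n then N else σ.net Y
  have hnode_in : ∀ v ∈ T, node' v = n := fun v hv => if_pos hv
  have hnode_out : ∀ v ∉ T, node' v = σ.node v := fun v hv => if_neg hv
  have hlive_in : ∀ v ∈ H, live' v = insert n (σ.live v) := fun v hv => if_pos hv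
  have hlive_out : ∀ v ∉ H, live' v = σ.live v := fun v hv => if_neg hv
  have hanc_n : anc' n = σ.live u := if_pos rfl
  have hanc : ∀ Y, Y ≠ n → anc' Y = σ.anc Y := fun Y hY => if_neg hY
  have hdom_n : dom' n = H := if_pos rfl
  have hdom : ∀ Y, Y ≠ n → dom' Y = σ.dom Y := fun Y hY => if_neg hY
  have hnet_n : net' n = N := if_pos rfl
  have hnet : ∀ Y, Y ≠ n → net' Y = σ.net Y := fun Y hY => if_neg hY
  have hT_top : ∀ v ∈ T, σ.node v = ⊤ := fun v hv => hHtop v (hTH hv)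
  have hnode_old : ∀ v (Y : ℕ), σ.node v = Y → node' v = Y := by
    intro v Y hv
    rw [hnode_out v, hv]
    intro hvT
    rw [hT_top v hvT] at hv
    exact ENat.top_ne_natCast _ hv
  have hnode_top : ∀ v, node' v = ⊤ → σ.node v = ⊤ ∧ v ∉ T := by
    intro v hv
    by_cases hvT : v ∈ T
    · rw [hnode_in v hvT] at hv
      exact absurd hv (ENat.natCast_ne_top n)
    · exact ⟨(hnode_out v hvT).symm.trans hv, hvT⟩
  have hnode_cases : ∀ v (Y : ℕ), node' v = Y →
      (σ.node v = Y ∧ Y < n) ∨ (v ∈ T ∧ Y = n) := by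
    intro v Y hv
    by_cases hvT : v ∈ T
    · rw [hnode_in v hvT] at hv
      exact Or.inr ⟨hvT, by exact_mod_cast hv.symm⟩
    · have := (hnode_out v hvT).symm.trans hv
      exact Or.inl ⟨this, σ.node_lt v Y this⟩
  have hnode_le : ∀ v, node' v ≤ σ.node v := by
    intro v
    by_cases hvT : v ∈ T
    · rw [hT_top v hvT]; exact le_top
    · rw [hnode_out v hvT]
  have hge_n : ∀ v, (n : ℕ∞) ≤ node' v → σ.node v = ⊤ := by
    intro v hv
    by_contra hne
    obtain ⟨Y, hY⟩ := ENat.ne_top_iff_exists.1 hne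
    have h1 := σ.node_lt v Y hY.symm
    have h2 : (n : ℕ∞) ≤ Y := by rw [hY]; exact hv.trans (hnode_le v)
    exact absurd (by exact_mod_cast h2 : n ≤ Y) (not_le.2 h1)
  have hclass : ∀ Y : ℕ, ∀ z ∈ {z | σ.node z = (Y : ℕ∞)}, z ∈ {z | node' z = (Y : ℕ∞)} :=
    fun Y z hz => hnode_old z Y hz
  have hclass_n : ∀ z ∈ T, z ∈ {z | node' z = (n : ℕ∞)} := fun z hz => hnode_in z hz
  have hup : ∀ Z : ℕ, ∀ z ∈ {z | (Z : ℕ∞) ≤ node' z}, z ∈ {z | (Z : ℕ∞) ≤ σ.node z} :=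
    fun Z z hz => le_trans (α := ℕ∞) hz (hnode_le z)
  have hlive_sup : ∀ v, σ.live v ⊆ live' v := by
    intro v
    by_cases hv : v ∈ H
    · rw [hlive_in v hv]; exact Finset.subset_insert _ _
    · rw [hlive_out v hv]
  have hlive_cases : ∀ v, ∀ Y ∈ live' v, Y ∈ σ.live v ∨ (v ∈ H ∧ Y = n) := by
    intro v Y hY
    by_cases hv : v ∈ H
    · rw [hlive_in v hv] at hY
      rcases Finset.mem_insert.1 hY with h | h
      exacts [Or.inr ⟨hv, h⟩, Or.inl h]
    · rw [hlive_out v hv] at hY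
      exact Or.inl hY
  have hpot : ∀ (Z : ℕ) v, Z ≠ n → (node' v = Z ∨ (node' v = ⊤ ∧ Z ∈ live' v)) →
      (σ.node v = Z ∨ (σ.node v = ⊤ ∧ Z ∈ σ.live v)) := by
    rintro Z v hZ (h | ⟨h, h'⟩)
    · rcases hnode_cases v Z h with h | h
      exacts [Or.inl h.1, absurd h.2 hZ]
    · rcases hlive_cases v Z h' with h' | h'
      exacts [Or.inr ⟨(hnode_top v h).1, h'⟩, absurd h'.2 hZ]
  have hpot_n : ∀ v, (node' v = n ∨ (node' v = ⊤ ∧ n ∈ live' v)) → v ∈ H := by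
    rintro v (h | ⟨h, h'⟩)
    · rcases hnode_cases v n h with h | h
      exacts [absurd h.2 (lt_irrefl n), hTH h.1]
    · rcases hlive_cases v n h' with h' | h'
      exacts [absurd (σ.live_lt v (hnode_top v h).1 n h') (lt_irrefl _), h'.1]
  let σ' : CopState G w r Δ :=
    { size := n + 1
      node := node'
      live := live'
      anc := anc'
      dom := dom'
      net := net'
      node_lt := by
        intro v Y hv
        rcases hnode_cases v Y hv with h | h <;> omega
      live_lt := by
        intro v hv Y hY
        rcases hlive_cases v Y hY with h | h
        · exact (σ.live_lt v (hnode_top v hv).1 Y h).trans (Nat.lt_succ_self _)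
        · omega
      live_adj := by
        intro a b ha hb hab
        have ha' := (hnode_top a ha).1
        have hb' := (hnode_top b hb).1
        have := σ.live_adj a b ha' hb' hab
        by_cases haH : a ∈ H
        · rw [hlive_in a haH, hlive_in b (σ.mem_comp_of_adj haH hb' hab), this]
        · rw [hlive_out a haH,
            hlive_out b (fun h => haH (σ.mem_comp_of_adj h ha' hab.symm)), this]
      mem_live := by
        intro a b Y ha hb hab
        have ha' := (hnode_top a ha).1
        rcases hnode_cases b Y hb with h | ⟨h, rfl⟩
        · exact hlive_sup a (σ.mem_live a b Y ha' h.1 hab)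
        · rw [hlive_in a (σ.mem_comp_of_adj (hTH h) ha' hab.symm)]
          exact Finset.mem_insert_self _ _
      anc_lt := by
        intro X Y hX
        by_cases hY : Y = n
        · rw [hY, hanc_n] at hX
          rw [hY]
          exact σ.live_lt u hu X hX
        · rw [hanc Y hY] at hX
          exact σ.anc_lt X Y hX
      anc_chain := by
        intro a ha X hX Y hY hXY
        have ha' := (hnode_top a ha).1
        rcases hlive_cases a Y hY with hY | ⟨haH, rfl⟩
        · have hYn := σ.live_lt a ha' Y hY
          rw [hanc Y hYn.ne]
          rcases hlive_cases a X hX with hX | ⟨-, rfl⟩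
          · exact σ.anc_chain a ha' X hX Y hY hXY
          · omega
        · rw [hanc_n, ← hHlive a haH]
          rcases hlive_cases a X hX with hX | ⟨-, rfl⟩
          · exact hX
          · omega
      anc_edge := by
        intro Y hY X hX
        by_cases hYn : Y = n
        · rw [hYn, hanc_n] at hX
          rw [hYn]
          exact ⟨hb X, h X, hnode_old _ _ (hbnode X hX), hnode_in _ (hhT X hX), (hadj X hX).symm⟩
        · rw [hanc Y hYn] at hX
          obtain ⟨x, y, hx, hy, hxy⟩ := σ.anc_edge Y (by omega) X hX
          exact ⟨x, y, hnode_old _ _ hx, hnode_old _ _ hy, hxy⟩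
      anc_card := by
        intro Y hY
        by_cases hYn : Y = n
        · rw [hYn, hanc_n]; exact hcard
        · rw [hanc Y hYn]; exact σ.anc_card Y (by omega)
      node_nonempty := by
        intro Y hY
        by_cases hYn : Y = n
        · rw [hYn]; exact ⟨u, hnode_in u huT⟩
        · exact (σ.node_nonempty Y (by omega)).imp fun v hv => hnode_old _ _ hv
      node_conn := by
        intro a b Y ha hb
        rcases hnode_cases a Y ha with h1 | h1 <;> rcases hnode_cases b Y hb with h2 | h2
        · exact (σ.node_conn a b Y h1.1 h2.1).mono (hclass Y)
        · omega
        · omega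
        · rw [h1.2]
          exact ((hTconn a h1.1).trans (hTconn b h2.1).symm).mono hclass_n
      net_node := by
        intro Y hY x hx
        by_cases hYn : Y = n
        · rw [hYn, hnet_n] at hx
          rw [hYn]
          exact hnode_in x (hNT x hx)
        · rw [hnet Y hYn] at hx
          exact hnode_old _ _ (σ.net_node Y (by omega) x hx)
      net_card := by
        intro Y hY
        by_cases hYn : Y = n
        · rw [hYn, hnet_n, hdom_n]; exact hNcard
        · rw [hnet Y hYn, hdom Y hYn]; exact σ.net_card Y (by omega)
      radius := by
        intro v Y hv
        rcases hnode_cases v Y hv with h | ⟨h, rfl⟩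
        · rw [hnet Y h.2.ne]
          obtain ⟨x, hx, hxw⟩ := σ.radius v Y h.1
          exact ⟨x, hx, hxw.mono (hclass Y) le_rfl⟩
        · rw [hnet_n]
          obtain ⟨x, hx, hxw⟩ := hNcov v h
          exact ⟨x, hx, hxw.mono hclass_n (by linarith)⟩
      radius_boundary := by
        intro a v Y ha hv hav
        have ha' := (hnode_top a ha).1
        rcases hnode_cases v Y hv with h | ⟨h, rfl⟩
        · rw [hnet Y h.2.ne]
          obtain ⟨x, hx, hxw⟩ := σ.radius_boundary a v Y ha' h.1 hav
          refine ⟨x, hx, hxw.mono (hclass Y) ?_⟩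
          have : (live' a).filter (· < Y) = (σ.live a).filter (· < Y) := by
            by_cases haH : a ∈ H
            · rw [hlive_in a haH, Finset.filter_insert, if_neg (by omega)]
            · rw [hlive_out a haH]
          rw [this]
        · rw [hnet_n]
          obtain ⟨x, hx, hxw⟩ := hNcov v h
          refine ⟨x, hx, hxw.mono hclass_n ?_⟩
          have haH := σ.mem_comp_of_adj (hTH h) ha' hav.symm
          have hle : ((live' a).filter (· < n)).card ≤ r := by
            refine le_trans (Finset.card_le_card ?_) hcard.le
            rw [hlive_in a haH, Finset.filter_insert, if_neg (lt_irrefl _), hHlive a haH]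
            exact Finset.filter_subset _ _
          have hle' : (((live' a).filter (· < n)).card : ℝ) ≤ r := by exact_mod_cast hle
          have := mul_nonneg hγ.le (sub_nonneg.2 hle')
          linarith
      node_dom := by
        intro v Y hv
        rcases hnode_cases v Y hv with h | ⟨h, rfl⟩
        · rw [hdom Y h.2.ne]
          exact σ.node_dom v Y h.1
        · rw [hdom_n]
          exact hTH h
      dom_closed := by
        intro Y hY a b ha hab hb
        by_cases hYn : Y = n
        · rw [hYn, hdom_n] at ha
          rw [hYn] at hb
          rw [hYn, hdom_n]
          exact σ.mem_comp_of_adj ha (hge_n b hb) hab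
        · rw [hdom Y hYn] at ha ⊢
          exact σ.dom_closed Y (by omega) a b ha hab (hb.trans (hnode_le b))
      buffer_unassigned := by
        intro v Z hv hZ x hx hw
        obtain ⟨hv', hvT⟩ := hnode_top v hv
        by_cases hZn : Z = n
        · subst hZn
          have hvH : v ∉ H := by
            intro hvH
            rw [hlive_in v hvH] at hZ
            exact hZ (Finset.mem_insert_self _ _)
          apply hvH
          -- Vertices now numbered at least `n` were all unassigned before, so the walk stays in one
          -- old component, while `n` can only occur in `H`.
          have hconn : ConnIn G {z | σ.node z = ⊤} v x := hw.connIn.mono fun z hz => hge_n z hz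
          exact ConnIn.trans (hpot_n x hx) hconn.symm
        · exact σ.buffer_unassigned v Z hv' (fun h => hZ (hlive_sup v h)) x (hpot Z x hZn hx)
            (hw.mono (hup Z) le_rfl)
      buffer := by
        intro v Z Y hv hZY hZ x hx hw
        rcases hnode_cases v Y hv with h | ⟨h, rfl⟩
        · rw [hanc Y h.2.ne] at hZ
          exact σ.buffer v Z Y h.1 hZY hZ x (hpot Z x (by omega) hx) (hw.mono (hup Z) le_rfl)
        · rw [hanc_n, ← hHlive v (hTH h)] at hZ
          exact σ.buffer_unassigned v Z (hT_top v h) hZ x (hpot Z x (by omega) hx)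
            (hw.mono (hup Z) le_rfl) }
  refine ⟨σ', Finset.card_lt_card ?_⟩
  refine ⟨fun v hv => ?_, fun hsub => ?_⟩
  · simp only [Finset.mem_filter, Finset.mem_univ, true_and] at hv ⊢
    exact (hnode_top v hv).1
  · have := hsub (Finset.mem_filter.2 ⟨Finset.mem_univ u, hu⟩)
    exact (hnode_top u (Finset.mem_filter.1 this).2).2 huT

/-- The construction ends with all vertices assigned. -/
lemma exists_complete [Finite V] (hr : 1 ≤ r) (hG : CompleteMinorFree r G) (hΔ : 0 < Δ) :
    ∃ σ : CopState G w r Δ, ∀ v, σ.node v ≠ ⊤ := by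
  classical
  have := Fintype.ofFinite V
  have : Nonempty (CopState G w r Δ) := ⟨initial G w r Δ⟩
  -- Creation may enlarge live sets but assigns a vertex; growth unassigns nothing and shrinks the
  -- live sets. Both thus lower the lexicographic measure.
  let μ : CopState G w r Δ → ℕ ×ₗ ℕ := fun σ => toLex (σ.rest, ∑ v, (σ.live v).card)
  let σ := Function.argmin μ
  have hmin : ∀ σ', ¬ μ σ' < μ σ := fun σ' => Function.not_lt_argmin μ σ'
  refine ⟨σ, fun u hu => ?_⟩
  by_cases h : ∀ X ∈ σ.live u, ∃ a ∈ σ.comp u, ∃ b, G.Adj a b ∧ σ.node b = X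
  · obtain ⟨σ', hσ'⟩ := σ.exists_create hG hΔ u hu h
    exact hmin σ' (Prod.Lex.toLex_lt_toLex.2 (Or.inl hσ'))
  · push Not at h
    obtain ⟨X, hX, hXadj⟩ := h
    obtain ⟨σ', h1, h2⟩ := σ.exists_grow hr hΔ u hu X hX hXadj
    refine hmin σ' (Prod.Lex.toLex_lt_toLex.2 ?_)
    rcases h1.lt_or_eq with h1 | h1
    exacts [Or.inl h1, Or.inr ⟨h1, h2⟩]

end CopState

/-! ### Shortcuts in the cluster graph -/

section Walks

variable {V : Type*} {G : SimpleGraph V} {w : Sym2 V → ℝ≥0}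

lemma within_of_mem_support {u v x y : V} (p : G.Walk u v) {ℓ : ℝ}
    (hp : (weightedLength w p : ℝ) < ℓ) (hx : x ∈ p.support) (hy : y ∈ p.support) :
    Within G w {z | z ∈ p.support} x y ℓ := by
  classical
  -- The positive slack `ℓ - weightedLength w p` makes the bound strict.
  have key : ∀ {u v : V} (q : G.Walk u v) (z : V), z ∈ q.support →
      Within G w {z | z ∈ q.support} u z (weightedLength w q + (ℓ - weightedLength w p)) := by
    intro u v q z hz
    refine ⟨q.takeUntil z hz, q.support_takeUntil_subset_support hz, ?_⟩
    have : (weightedLength w (q.takeUntil z hz) : ℝ) ≤ weightedLength w q := by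
      exact_mod_cast weightedLength_takeUntil_le q hz
    linarith
  have hxy : x ∈ (p.takeUntil y hy).support ∨ x ∈ (p.dropUntil y hy).support := by
    rw [← SimpleGraph.Walk.mem_support_append_iff, p.take_spec hy]
    exact hx
  rcases hxy with h | h
  · have h1 := key (p.takeUntil y hy).reverse x (by simpa using h)
    refine h1.symm.mono (fun z hz => ?_) ?_
    · exact p.support_takeUntil_subset_support hy (by simpa using hz)
    · have : (weightedLength w (p.takeUntil y hy) : ℝ) ≤ weightedLength w p := by
        exact_mod_cast weightedLength_takeUntil_le p hy
      rw [weightedLength_reverse]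
      linarith
  · have h1 := key (p.dropUntil y hy) x h
    refine h1.symm.mono (fun z hz => p.support_dropUntil_subset_support hy hz) ?_
    have : (weightedLength w (p.dropUntil y hy) : ℝ) ≤ weightedLength w p := by
      exact_mod_cast weightedLength_dropUntil_le p hy
    linarith

lemma weightedLength_induce {S : Set V} {u v : V} (p : G.Walk u v) (hp : ∀ z ∈ p.support, z ∈ S) :
    weightedLength (fun e => w (e.map Subtype.val)) (p.induce S hp) = weightedLength w p := by
  induction p with
  | nil => simp
  | cons h p ih =>
    simp only [SimpleGraph.Walk.induce_cons, weightedLength_cons, Sym2.map_mk]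
    rw [ih]

/-- A walk from `a` to `b` with at most `k` edges in the cluster graph, inside `S`. -/
def Hop (G : SimpleGraph V) (s : Setoid V) (S : Set (Quotient s)) (a b : Quotient s) (k : ℕ) :
    Prop :=
  ∃ Q : (clusterGraph G s).Walk a b, (∀ c ∈ Q.support, c ∈ S) ∧ Q.length ≤ k

namespace Hop

variable {s : Setoid V} {S T : Set (Quotient s)} {a b c : Quotient s} {k l : ℕ}

lemma refl (ha : a ∈ S) : Hop G s S a a k := ⟨.nil, by simpa using ha, by simp⟩

lemma trans (h : Hop G s S a b k) (h' : Hop G s S b c l) : Hop G s S a c (k + l) := by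
  obtain ⟨p, hp, hl⟩ := h
  obtain ⟨q, hq, hl'⟩ := h'
  refine ⟨p.append q, fun z hz => ?_, ?_⟩
  · rcases (SimpleGraph.Walk.mem_support_append_iff _ _).1 hz with h | h
    exacts [hp z h, hq z h]
  · rw [SimpleGraph.Walk.length_append]
    omega

lemma mono (h : Hop G s S a b k) (hS : S ⊆ T) (hk : k ≤ l) : Hop G s T a b l := by
  obtain ⟨p, hp, hl⟩ := h
  exact ⟨p, fun z hz => hS (hp z hz), hl.trans hk⟩

lemma of_adj {x y : V} (hxy : G.Adj x y) (hne : Quotient.mk s x ≠ Quotient.mk s y)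
    (hx : Quotient.mk s x ∈ S) (hy : Quotient.mk s y ∈ S) :
    Hop G s S (Quotient.mk s x) (Quotient.mk s y) 1 := by
  have h : (clusterGraph G s).Adj (Quotient.mk s x) (Quotient.mk s y) := ⟨hne, x, y, hxy, rfl, rfl⟩
  exact ⟨.cons h .nil, by simp [hx, hy], by simp⟩

end Hop

/-- The clusters that meet the walk `p`. -/
def walkClusters (s : Setoid V) {u v : V} (p : G.Walk u v) : Set (Quotient s) :=
  {c | ∃ x ∈ p.support, Quotient.mk s x = c}

lemma walkClusters_mono {s : Setoid V} {u v u' v' : V} {p : G.Walk u v} {q : G.Walk u' v'}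
    (h : p.support ⊆ q.support) : walkClusters s p ⊆ walkClusters s q := by
  rintro c ⟨x, hx, rfl⟩
  exact ⟨x, h hx, rfl⟩

lemma mem_walkClusters {s : Setoid V} {u v x : V} {p : G.Walk u v} (h : x ∈ p.support) :
    Quotient.mk s x ∈ walkClusters s p := ⟨x, h, rfl⟩

/-- The last vertex of a walk in the cluster of its first vertex. -/
lemma exists_last_in_cluster (s : Setoid V) {u v : V} (p : G.Walk u v) :
    Quotient.mk s u = Quotient.mk s v ∨
      ∃ x ∈ p.support, Quotient.mk s x = Quotient.mk s u ∧ ∃ y, G.Adj x y ∧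
        ∃ q : G.Walk y v, q.support ⊆ p.support ∧ weightedLength w q ≤ weightedLength w p ∧
          Quotient.mk s u ∉ walkClusters s q := by
  classical
  suffices h : ∀ (c : Quotient s) {u v : V} (p : G.Walk u v), c ∈ walkClusters s p →
      c = Quotient.mk s v ∨ ∃ x ∈ p.support, Quotient.mk s x = c ∧ ∃ y, G.Adj x y ∧
        ∃ q : G.Walk y v, q.support ⊆ p.support ∧ weightedLength w q ≤ weightedLength w p ∧
          c ∉ walkClusters s q from h _ p ⟨u, p.start_mem_support, rfl⟩
  intro c u v p
  induction p with
  | nil =>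
    rintro ⟨x, hx, rfl⟩
    left
    rw [show x = _ by simpa using hx]
  | @cons u u' v hadj p ih =>
    intro hc
    by_cases hcp : c ∈ walkClusters s p
    · rcases ih hcp with h | ⟨x, hx, hxc, y, hxy, q, hq, hql, hqc⟩
      · exact Or.inl h
      · refine Or.inr ⟨x, by simp [hx], hxc, y, hxy, q, fun z hz => by simp [hq hz],
          hql.trans ?_, hqc⟩
        rw [weightedLength_cons]
        exact le_add_self
    · right
      obtain ⟨x, hx, hxc⟩ := hc
      rcases List.mem_cons.1 (by simpa using hx) with rfl | hx
      · refine ⟨x, by simp, hxc, u', hadj, p, fun z hz => by simp [hz], ?_, hcp⟩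
        rw [weightedLength_cons]
        exact le_add_self
      · exact absurd ⟨x, hx, hxc⟩ hcp

/-- The first vertex of a walk in one of the clusters of `S`. -/
lemma exists_first_in_clusters {s : Setoid V} {S : Finset (Quotient s)} {u v : V} (p : G.Walk u v)
    (h : ∃ z ∈ p.support, Quotient.mk s z ∈ S) :
    ∃ y ∈ p.support, Quotient.mk s y ∈ S ∧
      (∃ r : G.Walk y v, r.support ⊆ p.support ∧ weightedLength w r ≤ weightedLength w p) ∧
      (y = u ∨ ∃ x, G.Adj x y ∧ ∃ q : G.Walk u x, q.support ⊆ p.support ∧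
        weightedLength w q ≤ weightedLength w p ∧ ∀ z ∈ q.support, Quotient.mk s z ∉ S) := by
  induction p with
  | nil =>
    obtain ⟨z, hz, hzS⟩ := h
    obtain rfl : z = _ := by simpa using hz
    exact ⟨z, by simp, hzS, ⟨.nil, fun _ h => h, le_rfl⟩, Or.inl rfl⟩
  | @cons u u' v hadj p ih =>
    by_cases hu : Quotient.mk s u ∈ S
    · exact ⟨u, by simp, hu, ⟨.cons hadj p, fun _ h => h, le_rfl⟩, Or.inl rfl⟩
    · have hp : weightedLength w p ≤ weightedLength w (SimpleGraph.Walk.cons hadj p) := by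
        rw [weightedLength_cons]
        exact le_add_self
      have hex : ∃ z ∈ p.support, Quotient.mk s z ∈ S := by
        obtain ⟨z, hz, hzS⟩ := h
        rcases List.mem_cons.1 (by simpa using hz) with rfl | hz
        exacts [absurd hzS hu, ⟨z, hz, hzS⟩]
      obtain ⟨y, hy, hyS, ⟨r, hr, hrl⟩, hq⟩ := ih hex
      refine ⟨y, by simp [hy], hyS, ⟨r, fun z hz => by simp [hr hz], hrl.trans hp⟩, Or.inr ?_⟩
      rcases hq with rfl | ⟨x, hxy, q, hq, hql, hqS⟩
      · refine ⟨u, hadj, .nil, by simp, by simp, by simpa using hu⟩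
      · refine ⟨x, hxy, .cons hadj q, fun z hz => ?_, by simpa using hql, fun z hz => ?_⟩
        · rcases List.mem_cons.1 (by simpa using hz) with rfl | hz
          exacts [by simp, by simp [hq hz]]
        · rcases List.mem_cons.1 (by simpa using hz) with rfl | hz
          exacts [hu, hqS z hz]

/-- If the pieces of a walk outside a set `S` of clusters can be shortcut to `F` edges of the
cluster graph, then the walk can be shortcut as well, using each cluster of `S` once. -/
lemma hop_of_cut {s : Setoid V} (F : ℕ) (S : Finset (Quotient s)) {u v : V} (p : G.Walk u v)
    (h : ∀ (x y : V) (q : G.Walk x y), q.support ⊆ p.support →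
      weightedLength w q ≤ weightedLength w p → (∀ z ∈ q.support, Quotient.mk s z ∉ S) →
      Hop G s (walkClusters s q) (Quotient.mk s x) (Quotient.mk s y) F) :
    Hop G s (walkClusters s p) (Quotient.mk s u) (Quotient.mk s v) (F + S.card * (F + 2)) := by
  classical
  induction hn : S.card generalizing S u v with
  | zero =>
    rw [Finset.card_eq_zero] at hn
    subst hn
    exact (h u v p (fun _ h => h) le_rfl (by simp)).mono subset_rfl (by simp)
  | succ n ih =>
    by_cases hS : ∃ z ∈ p.support, Quotient.mk s z ∈ S
    swap
    · push Not at hS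
      exact (h u v p (fun _ h => h) le_rfl hS).mono subset_rfl (by simp)
    -- It takes `F + 1` hops to reach the first cluster of `S`, none to pass to its last visit, and
    -- one to leave it. The rest of the walk avoids that cluster, so it can be erased from `S` at a
    -- cost of `F + 2`.
    obtain ⟨y, hy, hyS, ⟨t, ht, htl⟩, hfirst⟩ := exists_first_in_clusters (w := w) p hS
    have h1 : Hop G s (walkClusters s p) (Quotient.mk s u) (Quotient.mk s y) (F + 1) := by
      rcases hfirst with rfl | ⟨x, hxy, q, hq, hql, hqS⟩
      · exact .refl (mem_walkClusters hy)
      · refine ((h u x q hq hql hqS).mono (walkClusters_mono hq) le_rfl).trans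
          (.of_adj hxy (fun he => ?_) (mem_walkClusters (hq q.end_mem_support))
            (mem_walkClusters hy))
        exact hqS x q.end_mem_support (he ▸ hyS)
    rcases exists_last_in_cluster (w := w) s t with he | ⟨x, hx, hxy, y', hxy', q, hq, hql, hqy⟩
    · rw [← he]
      exact h1.mono subset_rfl (by nlinarith)
    have hqp : q.support ⊆ p.support := fun z hz => ht (hq hz)
    have h2 : Hop G s (walkClusters s p) (Quotient.mk s y) (Quotient.mk s y') 1 := by
      rw [← hxy]
      refine .of_adj hxy' (fun he => hqy ?_) (mem_walkClusters (ht hx))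
        (mem_walkClusters (hqp q.start_mem_support))
      rw [← hxy, he]
      exact mem_walkClusters q.start_mem_support
    have h3 := ih (S.erase (Quotient.mk s y)) q (fun a b q' hq' hql' hqS => by
      refine h a b q' (fun z hz => hqp (hq' hz)) (hql'.trans (hql.trans htl)) fun z hz hzS => ?_
      refine hqS z hz (Finset.mem_erase.2 ⟨fun he => hqy ?_, hzS⟩)
      rw [← he]
      exact mem_walkClusters (hq' hz)) (by rw [Finset.card_erase_of_mem hyS, hn]; rfl)
    exact ((h1.trans h2).trans (h3.mono (walkClusters_mono hqp) le_rfl)).mono subset_rfl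
      (by ring_nf; omega)

end Walks

/-- The number of hops needed for a walk whose vertices have all but `k` ancestors in common. -/
def hopBound (r : ℕ) : ℕ → ℕ
  | 0 => 0
  | k + 1 => hopBound r k + 6 * r * (hopBound r k + 2)

/-- Shifting by 2 makes the recursion geometric. -/
lemma hopBound_add_two (r k : ℕ) : hopBound r k + 2 = 2 * (6 * r + 1) ^ k := by
  induction k with
  | zero => rfl
  | succ k ih => rw [pow_succ, ← mul_assoc, ← ih, hopBound]; ring

lemma hopBound_le {r : ℕ} (hr : 2 ≤ r) : hopBound r r ≤ r ^ (5 * r) := by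
  have h1 : 6 * r + 1 ≤ r ^ 4 := by
    have : 2 ^ 3 ≤ r ^ 3 := Nat.pow_le_pow_left hr 3
    calc 6 * r + 1 ≤ 2 ^ 3 * r := by omega
      _ ≤ r ^ 3 * r := Nat.mul_le_mul_right r this
      _ = r ^ 4 := by ring
  calc hopBound r r ≤ hopBound r r + 2 := Nat.le_add_right _ _
    _ = 2 * (6 * r + 1) ^ r := hopBound_add_two r r
    _ ≤ r * (r ^ 4) ^ r := Nat.mul_le_mul hr (Nat.pow_le_pow_left h1 r)
    _ = r ^ (4 * r + 1) := by rw [← pow_mul, pow_succ, mul_comm]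
    _ ≤ r ^ (5 * r) := Nat.pow_le_pow_right (by omega) (by omega)

/-! ### Clusters inside supernodes and the recursion for short walks -/

namespace CopState

variable {V : Type*} {G : SimpleGraph V} {w : Sym2 V → ℝ≥0} {r : ℕ} {Δ : ℝ}

/-- Every supernode is partitioned into connected clusters around its centres. -/
lemma exists_clusters [Finite V] (σ : CopState G w r Δ) {node : V → ℕ}
    (hnode : ∀ v, σ.node v = node v) :
    ∃ κ : V → V, ∀ v, κ v ∈ σ.net (node v) ∧
      Within G w {u | node u = node v ∧ κ u = κ v} v (κ v) (2 * Δ) := by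
  choose c hc using fun Y : ℕ =>
    exists_voronoi G w {z | σ.node z = Y} {z | z ∈ σ.net Y} (2 * Δ)
  refine ⟨fun v => c (node v) v, fun v => ?_⟩
  obtain ⟨x, hx, hxw⟩ := σ.radius v _ (hnode v)
  obtain ⟨h1, h2⟩ := hc (node v) v (hnode v) ⟨x, hx, hxw.mono (fun z hz => Or.inr hz) le_rfl⟩
  refine ⟨h1, h2.mono ?_ le_rfl⟩
  rintro z (⟨hz, -, hzc⟩ | ⟨rfl, hz⟩)
  · have : node z = node v := by exact_mod_cast (hnode z).symm.trans hz
    exact ⟨this, by simp only [this, hzc]⟩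
  · exact absurd (σ.net_node _ (σ.node_lt _ _ (hnode v)) _ h1) hz

/-- Short walks can be shortcut in the cluster graph, by induction on the number of ancestors
that are not common to all vertices of the walk. -/
lemma hop_of_short (σ : CopState G w r Δ) (hr : 1 ≤ r) (hΔ : 0 < Δ) {node : V → ℕ}
    (hnode : ∀ v, σ.node v = node v) {κ : V → V}
    (hκ : ∀ v, κ v ∈ σ.net (node v) ∧
      Within G w {u | node u = node v ∧ κ u = κ v} v (κ v) (2 * Δ))
    (k : ℕ) (Z : Finset ℕ) (hZ : r ≤ Z.card + k) {u v : V} (p : G.Walk u v)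
    (hp : (weightedLength w p : ℝ) < Δ / r) (hZp : ∀ z ∈ p.support, Z ⊆ σ.anc (node z)) :
    Hop G (Setoid.ker κ) (walkClusters _ p) (Quotient.mk _ u) (Quotient.mk _ v)
      (hopBound r k) := by
  classical
  induction k generalizing Z u v with
  | zero =>
    -- Here `Z` has at least r elements, more than any supernode has ancestors.
    have h1 := Finset.card_le_card (hZp u p.start_mem_support)
    have h2 := σ.anc_card _ (σ.node_lt _ _ (hnode u))
    omega
  | succ k ih =>
    -- `X` is the earliest supernode on the walk, and `S` will be the set of its clusters that the
    -- walk meets.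
    obtain ⟨z₀, hz₀, hmin⟩ := Finset.exists_min_image p.support.toFinset node
      ⟨u, by simp⟩
    simp only [List.mem_toFinset] at hz₀ hmin
    set X := node z₀ with hX
    have hXlt : X < σ.size := σ.node_lt _ _ (hnode z₀)
    have hup : ∀ z ∈ p.support, (X : ℕ∞) ≤ σ.node z := by
      intro z hz
      rw [hnode z]
      exact_mod_cast hmin z hz
    let A : Finset V := p.support.toFinset.filter fun z => node z = X
    let S : Finset (Quotient (Setoid.ker κ)) := A.image (Quotient.mk _)
    have hA : ∀ z ∈ A, z ∈ p.support ∧ node z = X := by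
      intro z hz
      simpa [A] using hz
    have hscale : Δ / r ≤ Δ := div_le_self hΔ.le (by exact_mod_cast hr)
    have hdom : ∀ z ∈ p.support, z ∈ σ.dom X := fun z hz =>
      σ.mem_dom_of_connIn hXlt ((within_of_mem_support p hp hz₀ hz).connIn.mono hup)
        (σ.node_dom _ _ (hnode z₀))
    have hcell : ∀ z ∈ A, Within G w (σ.dom X) z (κ z) (2 * Δ) := by
      intro z hz
      refine (hκ z).2.mono (fun x hx => σ.node_dom x X ?_) le_rfl
      rw [hnode x, hx.1, (hA z hz).2]
    have hS : S.card ≤ 6 * r := by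
      calc S.card = (S.image (Setoid.kerLift κ)).card :=
            (Finset.card_image_of_injective _ (Setoid.kerLift_injective κ)).symm
        _ = (A.image κ).card := by rw [Finset.image_image]; rfl
        _ ≤ 6 * r := by
          refine σ.net_card X hXlt _ ?_ ?_
          · intro c hc
            obtain ⟨z, hz, rfl⟩ := Finset.mem_image.1 hc
            rw [← (hA z hz).2]
            exact (hκ z).1
          · intro a ha b hb
            obtain ⟨y, hy, rfl⟩ := Finset.mem_image.1 ha
            obtain ⟨z, hz, rfl⟩ := Finset.mem_image.1 hb
            -- Two centres are joined in `σ.dom X` by a walk of length below 2Δ + Δ/r + 2Δ ≤ 5Δ.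
            refine (((hcell y hy).symm.trans ((within_of_mem_support p hp (hA y hy).1
              (hA z hz).1).mono hdom le_rfl)).trans (hcell z hz)).mono (fun _ h => h) ?_
            linarith
    have hcut := hop_of_cut (w := w) (hopBound r k) S p fun x y q hqp hql hqS => by
      refine ih (insert X Z) ?_ q (lt_of_le_of_lt (by exact_mod_cast hql) hp) fun z hz => ?_
      · rw [Finset.card_insert_of_notMem fun hXZ => lt_irrefl X
          (σ.anc_lt _ _ (hZp z₀ hz₀ hXZ))]
        omega
      · have hzX : node z ≠ X := fun h =>
          hqS z hz (Finset.mem_image_of_mem _ (by simp [A, h, hqp hz]))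
        refine Finset.insert_subset ?_ (hZp z (hqp hz))
        -- The walk joins `z` to `z₀` in `X` too cheaply to cross a buffer, so `X` must be an
        -- ancestor of the supernode of `z`.
        by_contra hXz
        exact σ.buffer z X (node z) (hnode z) (lt_of_le_of_ne (hmin z (hqp hz)) hzX.symm) hXz z₀
          (Or.inl (hnode z₀)) ((within_of_mem_support p hp (hqp hz) hz₀).mono hup le_rfl)
    exact hcut.mono subset_rfl
      (Nat.add_le_add_left (Nat.mul_le_mul_right _ hS) _)

end CopState

theorem lemma4p1 :
    ∃ C : ℕ, ∀ (r : ℕ) (_ : 1 ≤ r) (V : Type*) [Finite V] (G : SimpleGraph V)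
      (w : Sym2 V → ℝ≥0) (_ : CompleteMinorFree r G) (Δ : ℝ) (_ : 0 < Δ),
      ∃ s : Setoid V,
        (∀ S ∈ s.classes, (G.induce S).Connected ∧
          strongDiam G w S ≤ ENNReal.ofReal (4 * Δ)) ∧
        ∀ (u v : V) (P : G.Walk u v), P.IsPath → (weightedLength w P : ℝ) < Δ / (r : ℝ) →
          pathCost s P ≤ ((r ^ (C * r) : ℕ) : ℕ∞) := by
  classical
  refine ⟨5, fun r hr V _ G w hG Δ hΔ => ?_⟩
  obtain ⟨σ, hσ⟩ := CopState.exists_complete (w := w) hr hG hΔ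
  choose node hnode using fun v => ENat.ne_top_iff_exists.1 (hσ v)
  replace hnode : ∀ v, σ.node v = node v := fun v => (hnode v).symm
  obtain ⟨κ, hκ⟩ := σ.exists_clusters hnode
  refine ⟨Setoid.ker κ, fun S hS => ?_, fun u v P _ hP => ?_⟩
  · obtain ⟨y, rfl⟩ := hS
    have hmem : ∀ a, a ∈ {x | Setoid.ker κ x y} ↔ κ a = κ y := fun a => Iff.rfl
    have hclose : ∀ a b, a ∈ {x | Setoid.ker κ x y} → b ∈ {x | Setoid.ker κ x y} →
        Within G w {x | Setoid.ker κ x y} a b (4 * Δ) := by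
      intro a b ha hb
      have key : ∀ a, κ a = κ y → Within G w {x | Setoid.ker κ x y} a (κ y) (2 * Δ) := by
        intro a ha
        rw [← ha]
        exact (hκ a).2.mono (fun z hz => hz.2.trans ha) le_rfl
      exact ((key a ha).trans (key b hb).symm).mono (fun _ h => h) (by linarith)
    refine ⟨?_, iSup₂_le fun a b => ?_⟩
    · have : Nonempty {x | Setoid.ker κ x y} := ⟨⟨y, rfl⟩⟩
      refine SimpleGraph.Connected.mk fun a b => ?_
      obtain ⟨p, hp, -⟩ := hclose a b a.2 b.2
      exact ⟨p.induce _ hp⟩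
    · obtain ⟨p, hp, hpl⟩ := hclose a b a.2 b.2
      refine (iInf_le _ (p.induce _ hp)).trans ?_
      rw [weightedLength_induce, ← ENNReal.ofReal_coe_nnreal]
      exact ENNReal.ofReal_le_ofReal hpl.le
  -- For r = 1 any vertex is a `K_1` minor, so no walk exists; the numerical bound `hopBound_le`
  -- needs r ≥ 2.
  · have hr2 : 2 ≤ r := by
      by_contra! hlt
      obtain rfl : r = 1 := by omega
      refine hG ⟨fun _ => {u}, fun _ => ?_, fun i j hij => absurd (Subsingleton.elim i j) hij,
        fun i j hij => absurd (Subsingleton.elim i j) hij.ne⟩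
      have : Nonempty ({u} : Set V) := ⟨⟨u, rfl⟩⟩
      exact SimpleGraph.Connected.mk fun a b => Subsingleton.elim a b ▸ .refl _
    obtain ⟨Q, hQ, hQl⟩ := σ.hop_of_short hr hΔ hnode hκ r ∅ (by simp) P hP (by simp)
    refine (iInf₂_le Q.bypass ⟨Q.bypass_isPath, fun c hc =>
      hQ c (Q.support_bypass_subset_support hc)⟩).trans ?_
    exact_mod_cast Q.length_bypass_le_length.trans (hQl.trans (hopBound_le hr2))
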